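/- **Setting.** Let $\mathbb K=\mathbb R$ or $\mathbb C$, and let $M\in\mathbb K^{n\times n}$ be unitary. Consider on $\mathbb K^n$ either the bilinear form $\langle x,y\rangle_M=y^TMx$ with $M^T=\pm M$ (then $*=T$), or the sesquilinear form $\langle x,y\rangle_M=y^HMx$ with $M^H=\pm M$ (then $*=H$). The adjoint of $A\in\mathbb K^{n\times n}$ is $A^\star=M^{-1}A^*M$. Let $\mathbb S$ be the Jordan algebra $\{A: A^\star=A\}$ or the Lie algebra $\{A:A^\star=-A\}$, and put $M\mathbb S=\{MA:A\in\mathbb S\}$. Then $M\mathbb S$ is one of the sets $\mathsf{sym}$ ($A^T=A$), $\mathsf{skew\text{-}sym}$ ($A^T=-A$), $\mathsf{Herm}$ ($A^H=A$), $\mathsf{skew\text{-}Herm}$ ($A^H=-A$), the last being considered in the spectral part below only for $\mathbb K=\mathbb C$. Put $*=T$ if $M\mathbb S\in\{\mathsf{sym},\mathsf{skew\text{-}sym}\}$ and $*=H$ if $M\mathbb S\in\{\mathsf{Herm},\mathsf{skew\text{-}Herm}\}$; put $\varepsilon=1$ if $M\mathbb S\in\{\mathsf{sym},\mathsf{Herm}\}$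 and $\varepsilon=-1$ otherwise. For $X,B\in\mathbb K^{n\times p}$ let $\mathbb S(X,B)=\{A\in\mathbb S: AX=B\}$ and, for a given norm, $\sigma^{\mathbb S}(X,B)=\inf\{\|A\|:A\in\mathbb S(X,B)\}$; write $\sigma^{\mathrm{unstruc}}$ for $\mathbb S=\mathbb K^{n\times n}$. Let $X^\dagger$ be the Moore–Penrose pseudoinverse of $X$, and $$\mathcal F_*^{\varepsilon}(X,B)=BX^\dagger+\varepsilon(BX^\dagger)^*-(X^\dagger)^*X^*BX^\dagger .$$ **Theorem.** Suppose $\mathbb S(X,B)\neq\emptyset$. Then $A\in\mathbb S(X,B)$ if and only if $$A=M^{-1}\mathcal F^\varepsilon_*(X,MB)+M^{-1}(I-XX^\dagger)^*Z(I-XX^\dagger)\quad\text{for some } Z\in M\mathbb S$$ (for $*=H$ one has $(I-XX^\dagger)^*=I-XX^\dagger$). **(a) Frobenius norm.** $A_o=M^{-1}\mathcal F_*^\varepsilon(X,MB)$ is the unique matrix in $\mathbb S(X,B)$ with $\|A_o\|_F=\sigma^{\mathbb S}(X,B)$, and $$\|A_o\|_F=\sqrt{2\|BX^\dagger\|_F^2-\mathrm{Tr}\big(MBX^\dagger(MBX^\dagger)^H(XX^\dagger)^*\big)},$$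 the trace being real. **(b) Spectral norm.** $\sigma^{\mathbb S}(X,B)=\|BX^\dagger\|_2=\sigma^{\mathrm{unstruc}}(X,B)$. Let $r=\mathrm{rank}(X)$, let $X=U\Sigma V^H$ be a singular value decomposition with singular values in nonincreasing order, $U=[U_1\ U_2]$ with $U_1\in\mathbb K^{n\times r}$, and put $Y=MBX^\dagger$, $\mu=\|BX^\dagger\|_2$. Below, $H^{1/2}$ is the positive semidefinite square root of a positive semidefinite matrix $H$, and $H^{-1/2}$ is the Moore–Penrose pseudoinverse of $H^{1/2}$; a contraction is an $(n-r)\times(n-r)$ matrix $Z$ with $\|Z\|_2\le1$. *Case I:* $M\mathbb S=\mathsf{sym}$ ($\varepsilon=1$) or $M\mathbb S=\mathsf{skew\text{-}sym}$ ($\varepsilon=-1$). Let $K=YU_1(\mu^2I-\varepsilon U_1^H\overline{Y}YU_1)^{-1/2}$. The matrices $A\in\mathbb S(X,B)$ with $\|A\|_2=\sigma^{\mathbb S}(X,B)$ are exactly $$M^{-1}\mathcal F_T^\varepsilon(X,MB)-M^{-1}(I-XX^\dagger)^TKU_1^H\overline{YU_1}K^T(I-XX^\dagger)+M^{-1}f(Z),$$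 $$f(Z)=\mu\overline U_2(I-U_2^TKK^H\overline U_2)^{1/2}Z(I-U_2^H\overline KK^TU_2)^{1/2}U_2^H,$$ where $Z$ is an arbitrary contraction with $Z^T=\varepsilon Z$. *Case II:* $M\mathbb S=\mathsf{Herm}$. Let $K=YU_1(\mu^2I-U_1^HYYU_1)^{-1/2}$. The matrices $A\in\mathbb S(X,B)$ with $\|A\|_2=\sigma^{\mathbb S}(X,B)$ are exactly $$\mathcal G_Z(X,B)=M^{-1}\mathcal F_H^{1}(X,MB)-M^{-1}(I-XX^\dagger)KU_1^HYU_1K^H(I-XX^\dagger)+M^{-1}f(Z),$$ $$f(Z)=\mu U_2(I-U_2^HKK^HU_2)^{1/2}Z(I-U_2^HKK^HU_2)^{1/2}U_2^H,$$ where $Z$ is an arbitrary contraction with $Z^H=Z$. *Case III:* $M\mathbb S=\mathsf{skew\text{-}Herm}$, $\mathbb K=\mathbb C$. The matrices $A\in\mathbb S(X,B)$ with $\|A\|_2=\sigma^{\mathbb S}(X,B)$ are exactly the matrices $-iG$, where $G$ is a matrix of smallest spectral norm among those with $MG$ Hermitian and $GX=iB$; equivalently, exactly the matrices $-i\,\mathcal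 G_Z(X,iB)$, where $\mathcal G_Z(X,iB)$ is given by the formulas of Case II with $B$ replaced by $iB$, and $Z$ is an arbitrary contraction with $Z^H=Z$. -/

import Mathlib

open Matrix

noncomputable section

namespace StructuredMapping

variable {𝕜 : Type*} [RCLike 𝕜]
variable {m n p : Type*} [Fintype m] [Fintype n] [Fintype p]

/-! ### Norms -/

open scoped Matrix.Norms.L2Operator in
/-- The spectral norm `‖A‖₂`: the operator norm with respect to the Euclidean norms. -/
def spectralNorm [DecidableEq n] (A : Matrix m n 𝕜) : ℝ := ‖A‖

open scoped Matrix.Norms.Frobenius in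
/-- The Frobenius norm `‖A‖_F`. -/
def frobeniusNorm (A : Matrix m n 𝕜) : ℝ := ‖A‖

/-! ### Moore-Penrose pseudoinverse and square roots -/

/-- The four Penrose equations: `Y` is the Moore-Penrose pseudoinverse of `X`. -/
structure IsMoorePenrose (X : Matrix m n 𝕜) (Y : Matrix n m 𝕜) : Prop where
  mul_mul_self : X * Y * X = X
  self_mul_mul : Y * X * Y = Y
  left_herm : (X * Y)ᴴ = X * Y
  right_herm : (Y * X)ᴴ = Y * X

open scoped ComplexOrder in
theorem exists_isMoorePenrose [DecidableEq n] (X : Matrix m n 𝕜) :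
    ∃ Y : Matrix n m 𝕜, IsMoorePenrose X Y := by
  have hG : IsSelfAdjoint (Xᴴ * X) := isHermitian_conjTranspose_mul_self X
  have hfin : (spectrum ℝ (Xᴴ * X)).Finite :=
    Matrix.finite_real_spectrum
  have hc : ∀ f : ℝ → ℝ, ContinuousOn f (spectrum ℝ (Xᴴ * X)) := fun f => hfin.continuousOn f
  obtain ⟨D, hD⟩ : ∃ D, D = cfc (fun t : ℝ => t⁻¹) (Xᴴ * X) := ⟨_, rfl⟩
  have hDs : Dᴴ = D := by
    rw [hD]; exact cfc_predicate (fun t : ℝ => t⁻¹) (Xᴴ * X)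
  have hid : cfc (fun t : ℝ => t) (Xᴴ * X) = Xᴴ * X := cfc_id' ℝ (Xᴴ * X)
  have h1 : D * (Xᴴ * X) = cfc (fun t : ℝ => t⁻¹ * t) (Xᴴ * X) := by
    rw [cfc_mul _ _ _ (hc _) (hc _), hid, hD]
  have h2 : (D * (Xᴴ * X))ᴴ = D * (Xᴴ * X) := by
    rw [h1]; exact cfc_predicate (fun t : ℝ => t⁻¹ * t) (Xᴴ * X)
  have h3 : D * (Xᴴ * X) * D = D := by
    rw [h1, hD, ← cfc_mul _ _ _ (hc _) (hc _)]
    congr 1; ext t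
    by_cases ht : t = 0
    · simp [ht]
    · field_simp
  have h4 : (Xᴴ * X) * (D * (Xᴴ * X)) = Xᴴ * X := by
    conv_lhs => rw [h1]
    conv_lhs => enter [1]; rw [← hid]
    rw [← cfc_mul _ _ _ (hc _) (hc _)]
    conv_rhs => rw [← hid]
    congr 1; ext t
    by_cases ht : t = 0
    · simp [ht]
    · field_simp
  have h5 : X * (D * (Xᴴ * X)) - X = 0 := by
    rw [← conjTranspose_mul_self_eq_zero]
    have : (X * (D * (Xᴴ * X)) - X)ᴴ * (X * (D * (Xᴴ * X)) - X)
        = (D * (Xᴴ * X)) * ((Xᴴ * X) * (D * (Xᴴ * X)) - Xᴴ * X)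
          - ((Xᴴ * X) * (D * (Xᴴ * X)) - Xᴴ * X) := by
      rw [conjTranspose_sub, conjTranspose_mul, h2]
      simp only [Matrix.mul_sub, Matrix.sub_mul, Matrix.mul_assoc]
      abel
    rw [this, h4]; simp
  refine ⟨D * Xᴴ, ?_, ?_, ?_, ?_⟩
  · simpa [Matrix.mul_assoc] using sub_eq_zero.mp h5
  · calc D * Xᴴ * X * (D * Xᴴ) = D * (Xᴴ * X) * D * Xᴴ := by simp only [Matrix.mul_assoc]
      _ = D * Xᴴ := by rw [h3]
  · simp [conjTranspose_mul, hDs, Matrix.mul_assoc]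
  · simpa [Matrix.mul_assoc] using h2

/-- The Moore-Penrose pseudoinverse `X†`. -/
def pinv [DecidableEq n] (X : Matrix m n 𝕜) : Matrix n m 𝕜 :=
  Classical.choose (exists_isMoorePenrose X)

/-- The positive semidefinite square root `H^{1/2}` of a positive semidefinite matrix. -/
def psdSqrt [DecidableEq n] (H : Matrix n n 𝕜) : Matrix n n 𝕜 := cfc Real.sqrt H

/-- `H^{-1/2}` for a positive semidefinite matrix `H`, the inverse being the Moore-Penrose
pseudoinverse when `H` is singular. -/
def psdInvSqrt [DecidableEq n] (H : Matrix n n 𝕜) : Matrix n n 𝕜 := pinv (psdSqrt H)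

/-- The entrywise complex conjugate of a matrix. -/
def conjMat (A : Matrix m n 𝕜) : Matrix m n 𝕜 := A.map (starRingEnd 𝕜)

/-! ### Scalar products, Jordan and Lie algebras -/

/-- The kind of a scalar product: bilinear `⟨x, y⟩ = yᵀ M x` or sesquilinear `⟨x, y⟩ = yᴴ M x`. -/
inductive FormKind
  | bilinear
  | sesquilinear

/-- `A^*`: the transpose for a bilinear, the conjugate transpose for a sesquilinear form. -/
def FormKind.tr (k : FormKind) (A : Matrix m n 𝕜) : Matrix n m 𝕜 :=
  match k with
  | .bilinear => Aᵀ
  | .sesquilinear => Aᴴ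

/-- The scalar product `⟨x, y⟩_M`. -/
def scalarProd (k : FormKind) (M : Matrix n n 𝕜) (x y : n → 𝕜) : 𝕜 :=
  match k with
  | .bilinear => y ⬝ᵥ (M *ᵥ x)
  | .sesquilinear => star y ⬝ᵥ (M *ᵥ x)

/-- The adjoint `A^⋆ = M⁻¹ A^* M` with respect to `⟨·, ·⟩_M`. -/
def adj [DecidableEq n] (k : FormKind) (M A : Matrix n n 𝕜) : Matrix n n 𝕜 :=
  M⁻¹ * k.tr A * M

/-- `adj k M A` is the adjoint of `A` with respect to the scalar product given by `M`. -/
theorem scalarProd_adj [DecidableEq n] (k : FormKind) (M A : Matrix n n 𝕜)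
    (hU : M ∈ Matrix.unitaryGroup n 𝕜) (hM : k.tr M = M ∨ k.tr M = -M) (x y : n → 𝕜) :
    scalarProd k M (A *ᵥ x) y = scalarProd k M x (adj k M A *ᵥ y) := by
  have hdet : IsUnit M.det := by
    have h := Matrix.mem_unitaryGroup_iff.mp hU
    have h' := congrArg Matrix.det h
    rw [det_mul, det_one] at h'
    exact IsUnit.of_mul_eq_one _ h'
  have key : k.tr (adj k M A) * M = M * A := by
    have hinv' : M⁻¹ * M = 1 := Matrix.nonsing_inv_mul M hdet
    have hneg : (-M)⁻¹ = -M⁻¹ := Matrix.inv_eq_left_inv (by rw [neg_mul_neg, hinv'])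
    cases k
    · simp only [FormKind.tr, adj, transpose_mul, transpose_transpose,
        transpose_nonsing_inv] at hM ⊢
      rcases hM with h | h
      · rw [h, Matrix.mul_assoc, Matrix.mul_assoc, hinv', Matrix.mul_one]
      · rw [h, hneg]
        simp [Matrix.mul_assoc, hinv']
    · simp only [FormKind.tr, adj, conjTranspose_mul, conjTranspose_conjTranspose,
        conjTranspose_nonsing_inv] at hM ⊢
      rcases hM with h | h
      · rw [h, Matrix.mul_assoc, Matrix.mul_assoc, hinv', Matrix.mul_one]
      · rw [h, hneg]
        simp [Matrix.mul_assoc, hinv']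
  cases k
  · simp only [scalarProd, FormKind.tr] at key ⊢
    rw [mulVec_mulVec, ← key, ← mulVec_mulVec, dotProduct_mulVec, vecMul_transpose]
  · simp only [scalarProd, FormKind.tr] at key ⊢
    rw [mulVec_mulVec, ← key, ← mulVec_mulVec, dotProduct_mulVec, vecMul_conjTranspose, star_star]

/-- Which of the two algebras attached to a scalar product is meant. -/
inductive AlgebraKind
  | jordan
  | lie

/-- The Jordan algebra `{A | A^⋆ = A}` or the Lie algebra `{A | A^⋆ = -A}` of `⟨·, ·⟩_M`. -/
def structuredSet [DecidableEq n] (k : FormKind) (M : Matrix n n 𝕜) (a : AlgebraKind) :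
    Set (Matrix n n 𝕜) :=
  match a with
  | .jordan => {A | adj k M A = A}
  | .lie => {A | adj k M A = -A}

/-- `M S = {M A | A ∈ S}`. -/
def leftMul (M : Matrix n n 𝕜) (S : Set (Matrix n n 𝕜)) : Set (Matrix n n 𝕜) :=
  (fun A => M * A) '' S

/-- The four prototype classes of structured matrices. -/
inductive MatrixClass
  | sym
  | skewSym
  | herm
  | skewHerm

namespace MatrixClass

/-- The set of matrices of the class. -/
def carrier (c : MatrixClass) (n : Type*) (𝕜 : Type*) [RCLike 𝕜] : Set (Matrix n n 𝕜) :=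
  match c with
  | sym => {A | Aᵀ = A}
  | skewSym => {A | Aᵀ = -A}
  | herm => {A | Aᴴ = A}
  | skewHerm => {A | Aᴴ = -A}

/-- Whether `^*` means transpose or conjugate transpose for the class. -/
def form : MatrixClass → FormKind
  | sym | skewSym => .bilinear
  | herm | skewHerm => .sesquilinear

/-- The sign `ε` in `A^* = ε A`. -/
def sign : MatrixClass → ℤ
  | sym | herm => 1
  | skewSym | skewHerm => -1

end MatrixClass

/-! ### The structured mapping problem -/

/-- `S(X, B) = {A ∈ S | A X = B}`. -/
def solutionSet (S : Set (Matrix n n 𝕜)) (X B : Matrix n p 𝕜) : Set (Matrix n n 𝕜) :=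
  {A | A ∈ S ∧ A * X = B}

/-- `σ^S(X, B) = inf {‖A‖ | A ∈ S(X, B)}` for the norm `N`. -/
def minNorm (N : Matrix n n 𝕜 → ℝ) (S : Set (Matrix n n 𝕜)) (X B : Matrix n p 𝕜) : ℝ :=
  sInf (N '' solutionSet S X B)

/-- `A` is an optimal solution: `A ∈ S(X, B)` and `‖A‖ = σ^S(X, B)`. -/
def IsOptimal (N : Matrix n n 𝕜 → ℝ) (S : Set (Matrix n n 𝕜)) (X B : Matrix n p 𝕜)
    (A : Matrix n n 𝕜) : Prop :=
  A ∈ solutionSet S X B ∧ N A = minNorm N S X B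

/-- `F_*(X, B) = B X† + ε (B X†)^* - (X†)^* (X^* B) X†`, where `ε = 1` or `ε = -1` according to
whether `X^* B` is to be (conjugate-)symmetric or (conjugate-)skew-symmetric. -/
def solMap [DecidableEq p] (k : FormKind) (ε : ℤ) (X B : Matrix n p 𝕜) : Matrix n n 𝕜 :=
  B * pinv X + ε • k.tr (B * pinv X) - k.tr (pinv X) * (k.tr X * B) * pinv X

/-! ### Singular value decomposition and the optimal families for the spectral norm -/

/-- `X = U Σ Vᴴ` is a singular value decomposition: `U`, `V` are unitary and `Σ` is rectangular
diagonal with nonnegative nonincreasing diagonal entries `s 0 ≥ s 1 ≥ ⋯`. -/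
structure IsSVD {n p : ℕ} (X : Matrix (Fin n) (Fin p) 𝕜) (U : Matrix (Fin n) (Fin n) 𝕜)
    (s : ℕ → ℝ) (V : Matrix (Fin p) (Fin p) 𝕜) : Prop where
  unitary_left : U ∈ Matrix.unitaryGroup (Fin n) 𝕜
  unitary_right : V ∈ Matrix.unitaryGroup (Fin p) 𝕜
  nonneg : ∀ i, 0 ≤ s i
  anti : Antitone s
  eq : X = U * (Matrix.of fun (i : Fin n) (j : Fin p) =>
    if (i : ℕ) = (j : ℕ) then ((s i : ℝ) : 𝕜) else 0) * Vᴴ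

/-- `U₁`: the first `r` columns of `U`. -/
def leftCols {n : ℕ} (U : Matrix (Fin n) (Fin n) 𝕜) (r : ℕ) :
    Matrix (Fin n) {i : Fin n // (i : ℕ) < r} 𝕜 :=
  U.submatrix id Subtype.val

/-- `U₂`: the remaining columns of `U`. -/
def rightCols {n : ℕ} (U : Matrix (Fin n) (Fin n) 𝕜) (r : ℕ) :
    Matrix (Fin n) {i : Fin n // r ≤ (i : ℕ)} 𝕜 :=
  U.submatrix id Subtype.val

/-- The matrix `A_o` attached to a contraction `Z` when `M S` is the class of symmetric (`ε = 1`)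
or skew-symmetric (`ε = -1`) matrices. -/
def familyT {n p : ℕ} (ε : ℤ) (M : Matrix (Fin n) (Fin n) 𝕜) (X B : Matrix (Fin n) (Fin p) 𝕜)
    (U : Matrix (Fin n) (Fin n) 𝕜)
    (Z : Matrix {i : Fin n // X.rank ≤ (i : ℕ)} {i : Fin n // X.rank ≤ (i : ℕ)} 𝕜) :
    Matrix (Fin n) (Fin n) 𝕜 :=
  let U₁ := leftCols U X.rank
  let U₂ := rightCols U X.rank
  let Y := M * B * pinv X
  let Q := 1 - X * pinv X
  let μ : 𝕜 := ((spectralNorm (B * pinv X) : ℝ) : 𝕜)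
  let K := Y * U₁ * psdInvSqrt (μ ^ 2 • 1 - ε • (U₁ᴴ * conjMat Y * Y * U₁))
  let fZ := μ • (conjMat U₂ * psdSqrt (1 - U₂ᵀ * K * Kᴴ * conjMat U₂) * Z *
    psdSqrt (1 - U₂ᴴ * conjMat K * Kᵀ * U₂) * U₂ᴴ)
  M⁻¹ * solMap .bilinear ε X (M * B)
    - M⁻¹ * Qᵀ * K * U₁ᴴ * conjMat (Y * U₁) * Kᵀ * Q + M⁻¹ * fZ

/-- The matrix `A_o` attached to a contraction `Z` when `M S` is the class of Hermitian
matrices. -/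
def familyH {n p : ℕ} (M : Matrix (Fin n) (Fin n) 𝕜) (X B : Matrix (Fin n) (Fin p) 𝕜)
    (U : Matrix (Fin n) (Fin n) 𝕜)
    (Z : Matrix {i : Fin n // X.rank ≤ (i : ℕ)} {i : Fin n // X.rank ≤ (i : ℕ)} 𝕜) :
    Matrix (Fin n) (Fin n) 𝕜 :=
  let U₁ := leftCols U X.rank
  let U₂ := rightCols U X.rank
  let Y := M * B * pinv X
  let Q := 1 - X * pinv X
  let μ : 𝕜 := ((spectralNorm (B * pinv X) : ℝ) : 𝕜)
  let K := Y * U₁ * psdInvSqrt (μ ^ 2 • 1 - U₁ᴴ * Y * Y * U₁)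
  let fZ := μ • (U₂ * psdSqrt (1 - U₂ᴴ * K * Kᴴ * U₂) * Z *
    psdSqrt (1 - U₂ᴴ * K * Kᴴ * U₂) * U₂ᴴ)
  M⁻¹ * solMap .sesquilinear 1 X (M * B)
    - M⁻¹ * Q * K * U₁ᴴ * Y * U₁ * Kᴴ * Q + M⁻¹ * fZ

end StructuredMapping

end

/-! Left multiplication by the unitary `M` preserves both norms and turns the problem into `H X = N`
with `H = M A`, `N = M B` and `H^* = ε H`. Put `P = X X†` and `Q = 1 - P`. Every such `H` equals `H
P + P^* H - P^* H P + Q^* H Q`. The first three terms depend only on `X` and `N`, because `H P = N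
X†` and `P^* H = ε (H P)^*`; their sum is `solMap` (`solMap_eq`, `solMap_add_eq`). The corner `Q^* H
Q` is free apart from its symmetry, which gives all solutions.

Frobenius norm: the free corner is orthogonal to `solMap`, so Pythagoras
(`frobeniusNorm_structured_sq`) makes the zero corner the unique optimum.

Spectral norm: `B X† = A P` gives the lower bound `μ = ‖B X†‖₂`. In an orthonormal basis `[U₁ U₂]`
adapted to `P`, `H` becomes a block matrix with rows `(a, ε c^*)` and `(c, x)`, whose first block
column has norm at most `μ` and whose corner `x` is free. This is the Davis-Kahan-Weinberger
dilation problem. With `D = (μ² - aᴴa)^{1/2}`, `c = K D` and `R = (1 - K Kᴴ)^{1/2}`, the corners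
keeping the norm at most `μ` are `x = -ε K aᴴ K^* + μ R Z R^*` for contractions `Z`. Both directions
rest on the Julia matrix with rows `(a, E)` and `(D, -aᴴ)`, `E = (μ² - a aᴴ)^{1/2}`, which is `μ`
times an isometry (`reInner_julia`). A contraction `Z` found this way can be replaced by `(Z + ε
Z^*)/2`, which has the required symmetry (`structured_dilation_iff`).

It remains to match block formulas with the stated ones, and to reduce the skew-Hermitian case to
the Hermitian one through multiplication by `i`. -/

noncomputable section

namespace StructuredMapping

section

variable {𝕜 : Type*} [RCLike 𝕜]
variable {l m n p : Type*} [Fintype l] [Fintype m] [Fintype n] [Fintype p]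

/-! ### Euclidean vectors -/

/-- The real part of the Euclidean inner product. -/
def reInner (u v : n → 𝕜) : ℝ := RCLike.re (star u ⬝ᵥ v)

theorem reInner_add_left (u v w : n → 𝕜) : reInner (u + v) w = reInner u w + reInner v w := by
  simp [reInner, add_dotProduct]

theorem reInner_add_right (u v w : n → 𝕜) : reInner u (v + w) = reInner u v + reInner u w := by
  simp [reInner, dotProduct_add]

theorem reInner_sub_left (u v w : n → 𝕜) : reInner (u - v) w = reInner u w - reInner v w := by
  simp [reInner, sub_dotProduct]

theorem reInner_sub_right (u v w : n → 𝕜) : reInner u (v - w) = reInner u v - reInner u w := by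
  simp [reInner, dotProduct_sub]

theorem reInner_smul_left (t : ℝ) (u v : n → 𝕜) :
    reInner ((t : 𝕜) • u) v = t * reInner u v := by
  simp [reInner, smul_dotProduct, RCLike.smul_re]

theorem reInner_smul_right (t : ℝ) (u v : n → 𝕜) :
    reInner u ((t : 𝕜) • v) = t * reInner u v := by
  simp [reInner, dotProduct_smul, RCLike.smul_re]

theorem reInner_comm (u v : n → 𝕜) : reInner u v = reInner v u := by
  rw [reInner, reInner, star_dotProduct, ← RCLike.conj_re]
  simp

theorem reInner_mulVec (A : Matrix m n 𝕜) (u : m → 𝕜) (v : n → 𝕜) :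
    reInner u (A *ᵥ v) = reInner (Aᴴ *ᵥ u) v := by
  rw [reInner, reInner, dotProduct_mulVec, star_mulVec, conjTranspose_conjTranspose]

theorem reInner_mulVec_left (A : Matrix m n 𝕜) (u : n → 𝕜) (v : m → 𝕜) :
    reInner (A *ᵥ u) v = reInner u (Aᴴ *ᵥ v) := by
  rw [reInner_mulVec, conjTranspose_conjTranspose]

theorem reInner_self (v : n → 𝕜) : reInner v v = ∑ i, ‖v i‖ ^ 2 := by
  simp [reInner, dotProduct, RCLike.conj_mul]

theorem reInner_self_nonneg (v : n → 𝕜) : 0 ≤ reInner v v := by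
  rw [reInner_self]; positivity

theorem reInner_self_eq_zero {v : n → 𝕜} (h : reInner v v = 0) : v = 0 := by
  rw [reInner_self, Finset.sum_eq_zero_iff_of_nonneg (fun _ _ => by positivity)] at h
  ext i
  simpa using h i (Finset.mem_univ i)

theorem reInner_sumElim (u v : m → 𝕜) (w z : n → 𝕜) :
    reInner (Sum.elim u w) (Sum.elim v z) = reInner u v + reInner w z := by
  simp [reInner, dotProduct]

@[simp] theorem reInner_zero_left (v : n → 𝕜) : reInner 0 v = 0 := by simp [reInner]

theorem two_mul_reInner_le (u v : n → 𝕜) : 2 * reInner u v ≤ reInner u u + reInner v v := by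
  have h := reInner_self_nonneg (u - v)
  rw [reInner_sub_left, reInner_sub_right, reInner_sub_right, reInner_comm v u] at h
  linarith

theorem norm_toLp_sq (v : n → 𝕜) : ‖WithLp.toLp 2 v‖ ^ 2 = reInner v v := by
  rw [EuclideanSpace.norm_sq_eq, reInner_self]

/-! ### The spectral norm -/

open scoped Matrix.Norms.L2Operator in
theorem spectralNorm_nonneg [DecidableEq n] (A : Matrix m n 𝕜) : 0 ≤ spectralNorm A :=
  norm_nonneg A

open scoped Matrix.Norms.L2Operator in
theorem spectralNorm_le_iff [DecidableEq n] {A : Matrix m n 𝕜} {μ : ℝ} (hμ : 0 ≤ μ) :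
    spectralNorm A ≤ μ ↔ ∀ v, reInner (A *ᵥ v) (A *ᵥ v) ≤ μ ^ 2 * reInner v v := by
  rw [spectralNorm, Matrix.l2_opNorm_def, ContinuousLinearMap.opNorm_le_iff hμ]
  constructor
  · intro h v
    have := h (WithLp.toLp 2 v)
    have h2 := pow_le_pow_left₀ (norm_nonneg _) this 2
    rw [mul_pow, norm_toLp_sq v] at h2
    rw [← norm_toLp_sq (A *ᵥ v)]
    exact h2
  · intro h x
    refine le_of_sq_le_sq ?_ (by positivity)
    have h2 := h x.ofLp
    rw [← norm_toLp_sq, ← norm_toLp_sq] at h2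
    rw [mul_pow]
    exact h2

open scoped Matrix.Norms.L2Operator in
theorem spectralNorm_mul_le [DecidableEq n] [DecidableEq m] (A : Matrix l m 𝕜)
    (B : Matrix m n 𝕜) : spectralNorm (A * B) ≤ spectralNorm A * spectralNorm B :=
  Matrix.l2_opNorm_mul A B

open scoped Matrix.Norms.L2Operator in
theorem spectralNorm_conjTranspose [DecidableEq n] [DecidableEq m] (A : Matrix m n 𝕜) :
    spectralNorm Aᴴ = spectralNorm A :=
  Matrix.l2_opNorm_conjTranspose A

open scoped Matrix.Norms.L2Operator in
theorem spectralNorm_smul [DecidableEq n] (t : 𝕜) (A : Matrix m n 𝕜) :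
    spectralNorm (t • A) = ‖t‖ * spectralNorm A :=
  norm_smul t A

open scoped Matrix.Norms.L2Operator in
theorem spectralNorm_add_le [DecidableEq n] (A B : Matrix m n 𝕜) :
    spectralNorm (A + B) ≤ spectralNorm A + spectralNorm B :=
  norm_add_le A B

theorem spectralNorm_le_one_of_isometry [DecidableEq n] {V : Matrix m n 𝕜} (h : Vᴴ * V = 1) :
    spectralNorm V ≤ 1 := by
  rw [spectralNorm_le_iff zero_le_one]
  intro v
  rw [reInner_mulVec_left, mulVec_mulVec, h]; simp

-- The transpose is the conjugate transpose of the entrywise conjugate, and conjugating all entries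
-- does not change Euclidean lengths.
open scoped Matrix.Norms.L2Operator in
theorem spectralNorm_transpose [DecidableEq n] [DecidableEq m] (A : Matrix m n 𝕜) :
    spectralNorm Aᵀ = spectralNorm A := by
  have key : ∀ {m n : Type _} [Fintype m] [Fintype n] [DecidableEq n] [DecidableEq m]
      (A : Matrix m n 𝕜), spectralNorm (A.map star) ≤ spectralNorm A := by
    intro m n _ _ _ _ A
    rw [spectralNorm_le_iff (spectralNorm_nonneg A)]
    intro v
    have h := (spectralNorm_le_iff (spectralNorm_nonneg A)).1 le_rfl (star v)
    have e : ∀ (w : n → 𝕜), reInner (star w) (star w) = reInner w w := by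
      intro w; simp [reInner_self]
    have e' : ∀ (w : m → 𝕜), reInner (star w) (star w) = reInner w w := by
      intro w; simp [reInner_self]
    have e2 : A.map star *ᵥ v = star (A *ᵥ star v) := by
      ext i; simp [mulVec, dotProduct]
    rw [e2, e', ← e v]
    exact h
  have h1 : Aᵀ = (A.map star)ᴴ := by ext; simp
  rw [h1, spectralNorm_conjTranspose]
  refine le_antisymm (key A) ?_
  have := key (A.map star)
  rwa [show (A.map star).map star = A by ext; simp] at this

/-! ### The Frobenius norm -/

open scoped Matrix.Norms.Frobenius in
theorem frobeniusNorm_nonneg (A : Matrix m n 𝕜) : 0 ≤ frobeniusNorm A := norm_nonneg A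

open scoped Matrix.Norms.Frobenius in
theorem frobeniusNorm_eq_zero {A : Matrix m n 𝕜} (h : frobeniusNorm A = 0) : A = 0 :=
  norm_eq_zero.1 h

open scoped Matrix.Norms.Frobenius in
theorem frobeniusNorm_sq (A : Matrix m n 𝕜) :
    frobeniusNorm A ^ 2 = RCLike.re (Matrix.trace (Aᴴ * A)) := by
  rw [frobeniusNorm, frobenius_norm_def, ← Real.sqrt_eq_rpow, Real.sq_sqrt (by positivity),
    Finset.sum_comm]
  simp [Matrix.trace, Matrix.mul_apply, RCLike.conj_mul]

/-! ### Moore-Penrose pseudoinverses -/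

theorem pinv_spec [DecidableEq n] (X : Matrix m n 𝕜) : IsMoorePenrose X (pinv X) :=
  Classical.choose_spec (exists_isMoorePenrose X)

/-! ### Square roots of positive semidefinite matrices -/

/-- Both spectra are finite, so Lagrange interpolation on their union gives one polynomial serving
both matrices. Algebraic relations between `P` and `Q` then pass to their square roots. -/
theorem exists_aeval_eq_psdSqrt [DecidableEq m] [DecidableEq n] {P : Matrix m m 𝕜}
    {Q : Matrix n n 𝕜} (hP : Pᴴ = P) (hQ : Qᴴ = Q) :
    ∃ q : Polynomial ℝ, psdSqrt P = Polynomial.aeval P q ∧ psdSqrt Q = Polynomial.aeval Q q := by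
  classical
  have hfP : (spectrum ℝ P).Finite := Matrix.finite_real_spectrum
  have hfQ : (spectrum ℝ Q).Finite := Matrix.finite_real_spectrum
  let s := (hfP.union hfQ).toFinset
  let q := Lagrange.interpolate s id Real.sqrt
  have hq : ∀ x ∈ s, q.eval x = √x := fun x hx =>
    Lagrange.eval_interpolate_at_node (v := id) Real.sqrt (Set.injOn_id _) hx
  refine ⟨q, ?_, ?_⟩
  · rw [← cfc_polynomial q P (show IsSelfAdjoint P from hP), psdSqrt]
    exact cfc_congr fun x hx => (hq x (by simp [s, hx])).symm
  · rw [← cfc_polynomial q Q (show IsSelfAdjoint Q from hQ), psdSqrt]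
    exact cfc_congr fun x hx => (hq x (by simp [s, hx])).symm

theorem psdSqrt_conjTranspose [DecidableEq n] (P : Matrix n n 𝕜) : (psdSqrt P)ᴴ = psdSqrt P :=
  cfc_predicate (R := ℝ) (p := IsSelfAdjoint) Real.sqrt P

open scoped ComplexOrder in
theorem psdSqrt_mul_self [DecidableEq n] {P : Matrix n n 𝕜} (hP : P.PosSemidef) :
    psdSqrt P * psdSqrt P = P := by
  have hs : IsSelfAdjoint P := hP.1
  have hf : (spectrum ℝ P).Finite := Matrix.finite_real_spectrum
  rw [psdSqrt, ← cfc_mul _ _ _ (hf.continuousOn _) (hf.continuousOn _)]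
  conv_rhs => rw [← cfc_id' ℝ P hs]
  refine cfc_congr fun x hx => ?_
  rw [hP.1.spectrum_real_eq_range_eigenvalues] at hx
  obtain ⟨i, rfl⟩ := hx
  exact Real.mul_self_sqrt (hP.eigenvalues_nonneg i)

theorem aeval_intertwine [DecidableEq m] [DecidableEq n] {P : Matrix m m 𝕜}
    {Q : Matrix n n 𝕜} {a : Matrix n m 𝕜} (h : a * P = Q * a) (q : Polynomial ℝ) :
    a * Polynomial.aeval P q = Polynomial.aeval Q q * a := by
  induction q using Polynomial.induction_on' with
  | add f g hf hg => simp only [map_add, Matrix.mul_add, Matrix.add_mul, hf, hg]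
  | monomial k t =>
    have hk : a * P ^ k = Q ^ k * a := by
      induction k with
      | zero => simp
      | succ k ih => rw [pow_succ, ← Matrix.mul_assoc, ih, Matrix.mul_assoc, h, pow_succ,
          Matrix.mul_assoc]
    simp [Polynomial.aeval_monomial, ← Algebra.smul_def, hk]

/-- Used to derive `a (μ² - aᴴa)^{1/2} = (μ² - a aᴴ)^{1/2} a`, the relation behind the Julia matrix.
-/
theorem psdSqrt_intertwine [DecidableEq m] [DecidableEq n] {P : Matrix m m 𝕜}
    {Q : Matrix n n 𝕜} {a : Matrix n m 𝕜} (hP : Pᴴ = P) (hQ : Qᴴ = Q) (h : a * P = Q * a) :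
    a * psdSqrt P = psdSqrt Q * a := by
  obtain ⟨q, h1, h2⟩ := exists_aeval_eq_psdSqrt hP hQ
  rw [h1, h2, aeval_intertwine h]

theorem psdSqrt_transpose [DecidableEq n] {P : Matrix n n 𝕜} (hP : Pᴴ = P) :
    psdSqrt Pᵀ = (psdSqrt P)ᵀ := by
  obtain ⟨q, h1, h2⟩ := exists_aeval_eq_psdSqrt hP (Q := Pᵀ)
    (congrArg transpose hP)
  rw [h1, h2]
  clear h1 h2
  induction q using Polynomial.induction_on' with
  | add f g hf hg => simp only [map_add, transpose_add, hf, hg]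
  | monomial k t => simp [Polynomial.aeval_monomial, ← Algebra.smul_def, transpose_pow]

end

section

variable {𝕜 : Type*} [RCLike 𝕜]
variable {l m n p : Type*} [Fintype l] [Fintype m] [Fintype n] [Fintype p]

/-! ### Positivity and projections -/

open scoped ComplexOrder in
theorem posSemidef_of_reInner {A : Matrix n n 𝕜} (hA : Aᴴ = A)
    (h : ∀ v, 0 ≤ reInner v (A *ᵥ v)) : A.PosSemidef := by
  refine PosSemidef.of_dotProduct_mulVec_nonneg hA fun v => ?_
  rw [RCLike.nonneg_iff]
  exact ⟨h v, Matrix.IsHermitian.im_star_dotProduct_mulVec_self hA v⟩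

open scoped ComplexOrder in
theorem posSemidef_one_sub_mul_conjTranspose [DecidableEq m] [DecidableEq n] {K : Matrix m n 𝕜}
    (hK : spectralNorm K ≤ 1) : (1 - K * Kᴴ).PosSemidef := by
  refine posSemidef_of_reInner (by simp) fun v => ?_
  rw [← spectralNorm_conjTranspose, spectralNorm_le_iff zero_le_one] at hK
  have h := hK v
  rw [sub_mulVec, one_mulVec, ← mulVec_mulVec, reInner_sub_right, reInner_mulVec]
  linarith

theorem reInner_projection_le {P : Matrix n n 𝕜} (h1 : Pᴴ = P) (h2 : P * P = P) (v : n → 𝕜) :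
    reInner (P *ᵥ v) (P *ᵥ v) ≤ reInner v v := by
  have h := two_mul_reInner_le v (P *ᵥ v)
  have e : reInner (P *ᵥ v) (P *ᵥ v) = reInner v (P *ᵥ v) := by
    rw [reInner_mulVec_left, h1, mulVec_mulVec, h2]
  linarith

theorem eq_zero_of_forall_mul_le {t C : ℝ} (h : ∀ s : ℝ, s * t ≤ C) : t = 0 := by
  by_contra ht
  have := h ((C + 1) / t)
  rw [div_mul_cancel₀ _ ht] at this
  linarith

theorem mulVec_eq_zero_of_reInner {A : Matrix m n 𝕜} {v : n → 𝕜}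
    (h : ∀ u, reInner u (A *ᵥ v) = 0) : A *ᵥ v = 0 :=
  reInner_self_eq_zero (h _)

theorem matrix_eq_zero_of_mulVec {ι : Type*} {A : Matrix ι n 𝕜} (h : ∀ v, A *ᵥ v = 0) : A = 0 := by
  classical
  ext i j
  have := congrFun (h (Pi.single j 1)) i
  simpa using this

/-- A two-sided factorization lemma of Douglas type. -/
theorem exists_contraction_factor [DecidableEq m] [DecidableEq n] {G : Matrix m n 𝕜}
    {R : Matrix m m 𝕜} {S : Matrix n n 𝕜} {μ : ℝ} (hμ : 0 < μ) (hR : Rᴴ = R)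
    (h : ∀ u v, 2 * reInner u (G *ᵥ v) ≤
      μ * (reInner (R *ᵥ u) (R *ᵥ u) + reInner (S *ᵥ v) (S *ᵥ v))) :
    ∃ Z : Matrix m n 𝕜, spectralNorm Z ≤ 1 ∧ G = (μ : 𝕜) • (R * Z * S) := by
  have sR := pinv_spec R
  have sS := pinv_spec S
  -- On a vector of `ker S` scaled by `s`, the left side of `h` is linear in `s` and the right side
  -- constant. Hence `G` kills `ker S`, and likewise `Gᴴ` kills `ker R`.
  have hl : G * (1 - pinv S * S) = 0 := by
    refine matrix_eq_zero_of_mulVec fun w => ?_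
    rw [← mulVec_mulVec]
    refine mulVec_eq_zero_of_reInner fun u => ?_
    have hz : S *ᵥ ((1 - pinv S * S) *ᵥ w) = 0 := by
      rw [mulVec_mulVec, Matrix.mul_sub, Matrix.mul_one, ← Matrix.mul_assoc, sS.mul_mul_self]
      simp
    refine eq_zero_of_forall_mul_le (C := μ * reInner (R *ᵥ u) (R *ᵥ u) / 2) fun s => ?_
    have := h u ((s : 𝕜) • ((1 - pinv S * S) *ᵥ w))
    rw [mulVec_smul, mulVec_smul, hz, reInner_smul_right] at this
    simp only [smul_zero, reInner_zero_left, add_zero] at this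
    linarith
  have hr : Gᴴ * (1 - pinv R * R) = 0 := by
    refine matrix_eq_zero_of_mulVec fun w => ?_
    rw [← mulVec_mulVec]
    refine mulVec_eq_zero_of_reInner fun u => ?_
    have hz : R *ᵥ ((1 - pinv R * R) *ᵥ w) = 0 := by
      rw [mulVec_mulVec, Matrix.mul_sub, Matrix.mul_one, ← Matrix.mul_assoc, sR.mul_mul_self]
      simp
    refine eq_zero_of_forall_mul_le (C := μ * reInner (S *ᵥ u) (S *ᵥ u) / 2) fun s => ?_
    have := h ((s : 𝕜) • ((1 - pinv R * R) *ᵥ w)) u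
    rw [mulVec_smul, hz, reInner_smul_left] at this
    simp only [smul_zero, reInner_zero_left, zero_add] at this
    rw [reInner_mulVec, conjTranspose_conjTranspose, reInner_comm]
    linarith
  have hl' : G * (pinv S * S) = G := by
    rw [Matrix.mul_sub, Matrix.mul_one, sub_eq_zero] at hl
    exact hl.symm
  have hr' : pinv R * R * G = G := by
    rw [Matrix.mul_sub, Matrix.mul_one, sub_eq_zero] at hr
    have := congrArg conjTranspose hr
    rw [conjTranspose_mul, conjTranspose_conjTranspose, sR.right_herm] at this
    exact this.symm
  have hRR : R * (pinv R)ᴴ = pinv R * R := by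
    rw [← sR.right_herm, conjTranspose_mul, hR]
  have hcancel : (μ : 𝕜) * ((μ⁻¹ : ℝ) : 𝕜) = 1 := by
    rw [← RCLike.ofReal_mul, mul_inv_cancel₀ hμ.ne', RCLike.ofReal_one]
  -- Solving `G = μ R Z S` by pseudoinverses; no invertibility is needed thanks to the two kernel
  -- inclusions.
  refine ⟨((μ⁻¹ : ℝ) : 𝕜) • ((pinv R)ᴴ * G * pinv S), ?_, ?_⟩
  · have key : ∀ u v, 2 * reInner u ((((μ⁻¹ : ℝ) : 𝕜) • ((pinv R)ᴴ * G * pinv S)) *ᵥ v) ≤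
        reInner u u + reInner v v := by
      intro u v
      have h0 := h (pinv R *ᵥ u) (pinv S *ᵥ v)
      have hPR := reInner_projection_le (P := R * pinv R) sR.left_herm
        (by rw [← Matrix.mul_assoc, sR.mul_mul_self]) u
      have hPS := reInner_projection_le (P := S * pinv S) sS.left_herm
        (by rw [← Matrix.mul_assoc, sS.mul_mul_self]) v
      rw [mulVec_mulVec, mulVec_mulVec, mulVec_mulVec, reInner_mulVec_left, mulVec_mulVec,
        ← Matrix.mul_assoc] at h0
      rw [smul_mulVec, reInner_smul_right]
      have h1 : 2 * reInner u (((pinv R)ᴴ * G * pinv S) *ᵥ v) ≤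
          μ * (reInner u u + reInner v v) := h0.trans (by gcongr)
      calc 2 * (μ⁻¹ * reInner u (((pinv R)ᴴ * G * pinv S) *ᵥ v))
          = μ⁻¹ * (2 * reInner u (((pinv R)ᴴ * G * pinv S) *ᵥ v)) := by ring
        _ ≤ μ⁻¹ * (μ * (reInner u u + reInner v v)) := by gcongr
        _ = _ := by rw [inv_mul_cancel_left₀ hμ.ne']
    rw [spectralNorm_le_iff zero_le_one]
    intro v
    -- Choosing `u = Z v` turns the bilinear bound into `2‖Zv‖² ≤ ‖Zv‖² + ‖v‖²`.
    have := key ((((μ⁻¹ : ℝ) : 𝕜) • ((pinv R)ᴴ * G * pinv S)) *ᵥ v) v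
    linarith
  · rw [Matrix.mul_smul, Matrix.smul_mul, smul_smul, hcancel, one_smul]
    calc G = pinv R * R * G * (pinv S * S) := by rw [hr', hl']
      _ = _ := by rw [← hRR]; simp only [Matrix.mul_assoc]

/-! ### Norm-preserving dilations of a block matrix -/

section Dilation

variable {m₁ m₂ n₁ n₂ : Type*} [Fintype m₁] [Fintype m₂] [Fintype n₁] [Fintype n₂]

/-- The diagonal terms add up by the formulas for `D²` and `E²`; the cross terms cancel because `a D
= E a`. -/
theorem reInner_julia [DecidableEq m] [DecidableEq n] {a : Matrix m n 𝕜} {D : Matrix n n 𝕜}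
    {E : Matrix m m 𝕜} {μ : ℝ} (hD : Dᴴ = D) (hE : Eᴴ = E)
    (hDD : D * D = (μ : 𝕜) ^ 2 • 1 - aᴴ * a) (hEE : E * E = (μ : 𝕜) ^ 2 • 1 - a * aᴴ)
    (haD : a * D = E * a) (v : n → 𝕜) (w : m → 𝕜) :
    reInner (a *ᵥ v + E *ᵥ w) (a *ᵥ v + E *ᵥ w) +
      reInner (D *ᵥ v - aᴴ *ᵥ w) (D *ᵥ v - aᴴ *ᵥ w) =
    μ ^ 2 * (reInner v v + reInner w w) := by
  have h1 : reInner (D *ᵥ v) (D *ᵥ v) = μ ^ 2 * reInner v v - reInner (a *ᵥ v) (a *ᵥ v) := by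
    rw [reInner_mulVec_left, hD, mulVec_mulVec, hDD, sub_mulVec, reInner_sub_right, smul_mulVec,
      one_mulVec, ← RCLike.ofReal_pow, reInner_smul_right, ← mulVec_mulVec,
      reInner_mulVec_left a]
  have h2 : reInner (E *ᵥ w) (E *ᵥ w) = μ ^ 2 * reInner w w - reInner (aᴴ *ᵥ w) (aᴴ *ᵥ w) := by
    rw [reInner_mulVec_left, hE, mulVec_mulVec, hEE, sub_mulVec, reInner_sub_right, smul_mulVec,
      one_mulVec, ← RCLike.ofReal_pow, reInner_smul_right, ← mulVec_mulVec, reInner_mulVec a]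
  have h3 : reInner (a *ᵥ v) (E *ᵥ w) = reInner (D *ᵥ v) (aᴴ *ᵥ w) := by
    have := congrArg conjTranspose haD
    rw [conjTranspose_mul, conjTranspose_mul, hD, hE] at this
    rw [reInner_mulVec_left, mulVec_mulVec, ← this, ← mulVec_mulVec, reInner_mulVec_left D, hD]
  simp only [reInner_add_left, reInner_add_right, reInner_sub_left, reInner_sub_right]
  rw [reInner_comm (E *ᵥ w) (a *ᵥ v), reInner_comm (aᴴ *ᵥ w) (D *ᵥ v), h1, h2, h3]
  ring

theorem spectralNorm_fromBlocks_le_iff [DecidableEq n₁] [DecidableEq n₂] {a : Matrix m₁ n₁ 𝕜}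
    {b : Matrix m₁ n₂ 𝕜} {c : Matrix m₂ n₁ 𝕜} {x : Matrix m₂ n₂ 𝕜} {μ : ℝ} (hμ : 0 ≤ μ) :
    spectralNorm (fromBlocks a b c x) ≤ μ ↔ ∀ v w,
      reInner (a *ᵥ v + b *ᵥ w) (a *ᵥ v + b *ᵥ w) + reInner (c *ᵥ v + x *ᵥ w) (c *ᵥ v + x *ᵥ w) ≤
        μ ^ 2 * (reInner v v + reInner w w) := by
  rw [spectralNorm_le_iff hμ]
  constructor
  · intro h v w
    have := h (Sum.elim v w)
    rw [fromBlocks_mulVec, reInner_sumElim, reInner_sumElim] at this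
    exact this
  · intro h v
    have := h (v ∘ Sum.inl) (v ∘ Sum.inr)
    rw [fromBlocks_mulVec, reInner_sumElim]
    conv_rhs => rw [← Sum.elim_comp_inl_inr v, reInner_sumElim]
    exact this

/-- The block matrix factors as `(v, w) ↦ (v, L w, S w)`, then the Julia matrix on the first two
components and `μ Z` on the third, then `(y, d, z) ↦ (y, K d + R z)`. The outer maps are an isometry
and a coisometry, and the middle one has norm at most `μ`. -/
theorem spectralNorm_dilation_le [DecidableEq m₁] [DecidableEq m₂] [DecidableEq n₁]
    [DecidableEq n₂] {a : Matrix m₁ n₁ 𝕜} {D : Matrix n₁ n₁ 𝕜} {E : Matrix m₁ m₁ 𝕜} {μ : ℝ}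
    (hμ : 0 ≤ μ) (hD : Dᴴ = D) (hE : Eᴴ = E)
    (hDD : D * D = (μ : 𝕜) ^ 2 • 1 - aᴴ * a) (hEE : E * E = (μ : 𝕜) ^ 2 • 1 - a * aᴴ)
    (haD : a * D = E * a) {K : Matrix m₂ n₁ 𝕜} {L : Matrix m₁ n₂ 𝕜} {R : Matrix m₂ m₂ 𝕜}
    {S : Matrix n₂ n₂ 𝕜} (hR : Rᴴ = R) (hS : Sᴴ = S) (hRR : R * R = 1 - K * Kᴴ)
    (hSS : S * S = 1 - Lᴴ * L) {Z : Matrix m₂ n₂ 𝕜} (hZ : spectralNorm Z ≤ 1) :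
    spectralNorm (fromBlocks a (E * L) (K * D) (-(K * aᴴ * L) + (μ : 𝕜) • (R * Z * S))) ≤ μ := by
  rw [spectralNorm_fromBlocks_le_iff hμ]
  intro v w
  have e1 : a *ᵥ v + (E * L) *ᵥ w = a *ᵥ v + E *ᵥ (L *ᵥ w) := by rw [mulVec_mulVec]
  have e2 : (K * D) *ᵥ v + (-(K * aᴴ * L) + (μ : 𝕜) • (R * Z * S)) *ᵥ w =
      K *ᵥ (D *ᵥ v - aᴴ *ᵥ (L *ᵥ w)) + R *ᵥ ((μ : 𝕜) • (Z *ᵥ (S *ᵥ w))) := by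
    simp only [add_mulVec, neg_mulVec, smul_mulVec, mulVec_sub, mulVec_smul, mulVec_mulVec,
      Matrix.mul_assoc]
    abel
  rw [e1, e2]
  have hj := reInner_julia hD hE hDD hEE haD v (L *ᵥ w)
  have hs : reInner w w = reInner (L *ᵥ w) (L *ᵥ w) + reInner (S *ᵥ w) (S *ᵥ w) := by
    rw [reInner_mulVec_left S, hS, mulVec_mulVec, hSS, sub_mulVec, one_mulVec, reInner_sub_right,
      ← mulVec_mulVec, reInner_mulVec_left]
    ring
  have hz : reInner ((μ : 𝕜) • (Z *ᵥ (S *ᵥ w))) ((μ : 𝕜) • (Z *ᵥ (S *ᵥ w))) ≤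
      μ ^ 2 * reInner (S *ᵥ w) (S *ᵥ w) := by
    rw [reInner_smul_left, reInner_smul_right]
    have := (spectralNorm_le_iff zero_le_one).1 hZ (S *ᵥ w)
    nlinarith [sq_nonneg μ]
  -- The row `(K, R)` is a contraction because its adjoint `y ↦ (Kᴴ y, R y)` preserves length.
  have hrow : ∀ d z, reInner (K *ᵥ d + R *ᵥ z) (K *ᵥ d + R *ᵥ z) ≤
      reInner d d + reInner z z := by
    intro d z
    obtain ⟨y, hy⟩ : ∃ y, y = K *ᵥ d + R *ᵥ z := ⟨_, rfl⟩
    have h1 : reInner y y = reInner (Kᴴ *ᵥ y) d + reInner (R *ᵥ y) z := by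
      conv_lhs => rw [hy, reInner_add_right, reInner_mulVec, reInner_mulVec R, hR, ← hy]
    have h2 : reInner y y = reInner (Kᴴ *ᵥ y) (Kᴴ *ᵥ y) + reInner (R *ᵥ y) (R *ᵥ y) := by
      rw [reInner_mulVec_left R, hR, mulVec_mulVec, hRR, sub_mulVec, one_mulVec,
        reInner_sub_right, ← mulVec_mulVec, reInner_mulVec K]
      ring
    have h3 := two_mul_reInner_le (Kᴴ *ᵥ y) d
    have h4 := two_mul_reInner_le (R *ᵥ y) z
    rw [← hy]
    linarith
  have := hrow (D *ᵥ v - aᴴ *ᵥ (L *ᵥ w)) ((μ : 𝕜) • (Z *ᵥ (S *ᵥ w)))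
  rw [hs]
  linarith

/-- Necessity in the dilation problem: the defect of `x` from the central corner `-K aᴴ L` satisfies
the hypothesis of `exists_contraction_factor`. The norm bound is tested on a vector `(p, v)` with
`p` adapted to both `u` and `v`. -/
theorem two_mul_reInner_dilation_le [DecidableEq m₁] [DecidableEq m₂] [DecidableEq n₁]
    [DecidableEq n₂] {a : Matrix m₁ n₁ 𝕜} {D : Matrix n₁ n₁ 𝕜} {E : Matrix m₁ m₁ 𝕜} {μ : ℝ}
    (hμ : 0 < μ) (hD : Dᴴ = D) (hE : Eᴴ = E)
    (hDD : D * D = (μ : 𝕜) ^ 2 • 1 - aᴴ * a) (hEE : E * E = (μ : 𝕜) ^ 2 • 1 - a * aᴴ)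
    (haD : a * D = E * a) {K : Matrix m₂ n₁ 𝕜} {L : Matrix m₁ n₂ 𝕜} {R : Matrix m₂ m₂ 𝕜}
    {S : Matrix n₂ n₂ 𝕜} (hR : Rᴴ = R) (hS : Sᴴ = S) (hRR : R * R = 1 - K * Kᴴ)
    (hSS : S * S = 1 - Lᴴ * L) {κ : Matrix n₁ m₂ 𝕜} (hκ : Kᴴ = D * κ) {lam : Matrix m₁ n₂ 𝕜}
    (hlam : L = E * lam) {x : Matrix m₂ n₂ 𝕜}
    (hx : spectralNorm (fromBlocks a (E * L) (K * D) x) ≤ μ) (u : m₂ → 𝕜) (v : n₂ → 𝕜) :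
    2 * reInner u ((x + K * aᴴ * L) *ᵥ v) ≤
      μ * (reInner (R *ᵥ u) (R *ᵥ u) + reInner (S *ᵥ v) (S *ᵥ v)) := by
  -- This `p` solves `D p - aᴴ L v = μ Kᴴ u`, so the second Julia component of `(p, L v)` is
  -- prescribed by `u`. The factorizations of `Kᴴ` through `D` and of `L` through `E` make it
  -- solvable.
  obtain ⟨p, hp⟩ : ∃ p, p = aᴴ *ᵥ (lam *ᵥ v) + (μ : 𝕜) • (κ *ᵥ u) := ⟨_, rfl⟩
  obtain ⟨k, hk⟩ : ∃ k, k = Kᴴ *ᵥ u := ⟨_, rfl⟩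
  obtain ⟨w, hw⟩ : ∃ w, w = L *ᵥ v := ⟨_, rfl⟩
  obtain ⟨q, hq⟩ : ∃ q, q = ((μ⁻¹ : ℝ) : 𝕜) • (a *ᵥ p + E *ᵥ w) := ⟨_, rfl⟩
  have hcancel : (μ : 𝕜) * ((μ⁻¹ : ℝ) : 𝕜) = 1 := by
    rw [← RCLike.ofReal_mul, mul_inv_cancel₀ hμ.ne', RCLike.ofReal_one]
  have hq' : a *ᵥ p + E *ᵥ w = (μ : 𝕜) • q := by
    rw [hq, smul_smul, hcancel, one_smul]
  have haE : aᴴ * E = D * aᴴ := by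
    have := congrArg conjTranspose haD
    rw [conjTranspose_mul, conjTranspose_mul, hD, hE] at this
    exact this.symm
  have hDp : D *ᵥ p - aᴴ *ᵥ w = (μ : 𝕜) • k := by
    rw [hp, hw, hk, hκ, hlam, mulVec_add, mulVec_smul, mulVec_mulVec, mulVec_mulVec, mulVec_mulVec,
      mulVec_mulVec, ← Matrix.mul_assoc aᴴ, haE, Matrix.mul_assoc]
    abel
  have hj := reInner_julia hD hE hDD hEE haD p w
  rw [hq', hDp] at hj
  simp only [reInner_smul_left, reInner_smul_right] at hj
  have hj' : reInner q q + reInner k k = reInner p p + reInner w w := by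
    have hne : μ ^ 2 ≠ 0 := by positivity
    refine mul_left_cancel₀ hne ?_
    rw [← hj]; ring
  have hT := (spectralNorm_fromBlocks_le_iff hμ.le).1 hx p v
  rw [← mulVec_mulVec, ← hw, hq'] at hT
  have e2 : (K * D) *ᵥ p + x *ᵥ v = (x + K * aᴴ * L) *ᵥ v + (μ : 𝕜) • (K *ᵥ k) := by
    rw [← mulVec_mulVec, show D *ᵥ p = aᴴ *ᵥ w + (μ : 𝕜) • k by rw [← hDp]; abel, hw, mulVec_add,
      mulVec_smul, mulVec_mulVec, mulVec_mulVec, add_mulVec]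
    abel
  rw [e2] at hT
  obtain ⟨g, hg⟩ : ∃ g, g = (x + K * aᴴ * L) *ᵥ v := ⟨_, rfl⟩
  rw [← hg] at hT ⊢
  have hs : reInner v v = reInner w w + reInner (S *ᵥ v) (S *ᵥ v) := by
    rw [hw, reInner_mulVec_left S, hS, mulVec_mulVec, hSS, sub_mulVec, one_mulVec,
      reInner_sub_right, ← mulVec_mulVec, reInner_mulVec_left]
    ring
  have hr : reInner u u = reInner k k + reInner (R *ᵥ u) (R *ᵥ u) := by
    rw [hk, reInner_mulVec_left R, hR, mulVec_mulVec, hRR, sub_mulVec, one_mulVec,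
      reInner_sub_right, ← mulVec_mulVec, reInner_mulVec K]
    ring
  have hpair : reInner u (g + (μ : 𝕜) • (K *ᵥ k)) = reInner u g + μ * reInner k k := by
    rw [reInner_add_right, reInner_smul_right, reInner_mulVec, ← hk]
  -- The bound `hT` amounts to `‖g + μ K k‖² ≤ μ²(‖k‖² + ‖S v‖²)`. Pairing with `μ u` makes all
  -- terms in `‖k‖²` cancel, and a factor `μ` remains to be divided out.
  have hcs := two_mul_reInner_le ((μ : 𝕜) • u) (g + (μ : 𝕜) • (K *ᵥ k))
  rw [reInner_smul_left, hpair, reInner_smul_left, reInner_smul_right] at hcs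
  simp only [reInner_smul_left, reInner_smul_right] at hT
  refine le_of_mul_le_mul_left ?_ hμ
  have hmul : μ ^ 2 * (reInner q q + reInner k k) = μ ^ 2 * (reInner p p + reInner w w) := by
    rw [hj']
  rw [hs] at hT
  rw [hr] at hcs
  nlinarith

end Dilation

end

section

variable {𝕜 : Type*} [RCLike 𝕜]

/-! ### The operation `A ↦ A^*` -/

namespace FormKind

variable {l m n : Type*} (k : FormKind)

theorem tr_mul [Fintype m] (A : Matrix l m 𝕜) (B : Matrix m n 𝕜) : k.tr (A * B) = k.tr B * k.tr A := by
  cases k <;> simp [tr]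

theorem tr_add (A B : Matrix m n 𝕜) : k.tr (A + B) = k.tr A + k.tr B := by
  cases k <;> simp [tr]

theorem tr_sub (A B : Matrix m n 𝕜) : k.tr (A - B) = k.tr A - k.tr B := by
  cases k <;> simp [tr]

theorem tr_neg (A : Matrix m n 𝕜) : k.tr (-A) = -k.tr A := by
  cases k <;> simp [tr]

theorem tr_tr (A : Matrix m n 𝕜) : k.tr (k.tr A) = A := by
  cases k <;> simp [tr]

theorem tr_one [DecidableEq n] : k.tr (1 : Matrix n n 𝕜) = 1 := by
  cases k <;> simp [tr]

theorem tr_zsmul (ε : ℤ) (A : Matrix m n 𝕜) : k.tr (ε • A) = ε • k.tr A := by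
  cases k <;> ext <;> simp [tr]

theorem tr_smul_ofReal (t : ℝ) (A : Matrix m n 𝕜) : k.tr ((t : 𝕜) • A) = (t : 𝕜) • k.tr A := by
  cases k <;> ext <;> simp [tr, RCLike.real_smul_eq_coe_mul]

theorem tr_conjTranspose (A : Matrix m n 𝕜) : k.tr Aᴴ = (k.tr A)ᴴ := by
  cases k <;> ext <;> simp [tr]

variable [Fintype m] [Fintype n]

theorem spectralNorm_tr [DecidableEq m] [DecidableEq n] (A : Matrix m n 𝕜) :
    spectralNorm (k.tr A) = spectralNorm A := by
  cases k
  · exact spectralNorm_transpose A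
  · exact spectralNorm_conjTranspose A

theorem psdSqrt_tr [DecidableEq n] {P : Matrix n n 𝕜} (hP : Pᴴ = P) :
    psdSqrt (k.tr P) = k.tr (psdSqrt P) := by
  cases k
  · exact psdSqrt_transpose hP
  · simp only [tr, hP, psdSqrt_conjTranspose]

end FormKind

/-! ### Structured dilations -/

section Structured

variable {n₁ n₂ : Type*} [Fintype n₁] [Fintype n₂] [DecidableEq n₁] [DecidableEq n₂]

theorem zsmul_zsmul_of_sign {ε : ℤ} (hε : ε = 1 ∨ ε = -1) {α : Type*} [AddCommGroup α] (x : α) :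
    ε • ε • x = x := by
  rcases hε with rfl | rfl <;> simp

open scoped ComplexOrder in
/-- The structure-preserving matrices of norm at most `μ` with a prescribed first block column. -/
theorem structured_dilation_iff (k : FormKind) {ε : ℤ} (hε : ε = 1 ∨ ε = -1) {μ : ℝ} (hμ : 0 ≤ μ)
    {a : Matrix n₁ n₁ 𝕜} {c : Matrix n₂ n₁ 𝕜} (ha : k.tr a = ε • a)
    (hcol : ∀ v, reInner (a *ᵥ v) (a *ᵥ v) + reInner (c *ᵥ v) (c *ᵥ v) ≤ μ ^ 2 * reInner v v)
    {K : Matrix n₂ n₁ 𝕜} (hK : K = c * psdInvSqrt ((μ : 𝕜) ^ 2 • 1 - aᴴ * a))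
    {R : Matrix n₂ n₂ 𝕜} (hR : R = psdSqrt (1 - K * Kᴴ)) (x : Matrix n₂ n₂ 𝕜) :
    (k.tr x = ε • x ∧ spectralNorm (fromBlocks a (ε • k.tr c) c x) ≤ μ) ↔
      ∃ Z : Matrix n₂ n₂ 𝕜, k.tr Z = ε • Z ∧ spectralNorm Z ≤ 1 ∧
        x = -(ε • (K * aᴴ * k.tr K)) + (μ : 𝕜) • (R * Z * k.tr R) := by
  obtain ⟨P, hP⟩ : ∃ P, P = (μ : 𝕜) ^ 2 • 1 - aᴴ * a := ⟨_, rfl⟩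
  rw [← hP] at hK
  have hPs : Pᴴ = P := by simp [hP, conjTranspose_smul]
  have hPpsd : P.PosSemidef := by
    refine posSemidef_of_reInner hPs fun v => ?_
    rw [hP, sub_mulVec, reInner_sub_right, smul_mulVec, one_mulVec, ← RCLike.ofReal_pow,
      reInner_smul_right, ← mulVec_mulVec, ← reInner_mulVec_left]
    have := hcol v
    have := reInner_self_nonneg (c *ᵥ v)
    linarith
  obtain ⟨D, hD⟩ : ∃ D, D = psdSqrt P := ⟨_, rfl⟩
  have hDs : Dᴴ = D := by rw [hD, psdSqrt_conjTranspose]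
  have hDD : D * D = P := by rw [hD, psdSqrt_mul_self hPpsd]
  have hK' : K = c * pinv D := by rw [hK, hD, psdInvSqrt]
  have sD := pinv_spec D
  have hcD : ∀ v, reInner (c *ᵥ v) (c *ᵥ v) ≤ reInner (D *ᵥ v) (D *ᵥ v) := by
    intro v
    rw [reInner_mulVec_left D, hDs, mulVec_mulVec, hDD, hP, sub_mulVec, reInner_sub_right,
      smul_mulVec, one_mulVec, ← RCLike.ofReal_pow, reInner_smul_right, ← mulVec_mulVec,
      ← reInner_mulVec_left]
    have := hcol v
    linarith
  -- Since `‖c v‖ ≤ ‖D v‖`, `ker D` lies in `ker c`; hence `c D† D = c` even when `D` is singular.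
  have hKD : K * D = c := by
    have : c * (1 - pinv D * D) = 0 := by
      refine matrix_eq_zero_of_mulVec fun w => ?_
      rw [← mulVec_mulVec]
      have hz : D *ᵥ ((1 - pinv D * D) *ᵥ w) = 0 := by
        rw [mulVec_mulVec, Matrix.mul_sub, Matrix.mul_one, ← Matrix.mul_assoc, sD.mul_mul_self]
        simp
      have h1 := hcD ((1 - pinv D * D) *ᵥ w)
      rw [hz, reInner_zero_left] at h1
      exact reInner_self_eq_zero (le_antisymm h1 (reInner_self_nonneg _))
    rw [Matrix.mul_sub, Matrix.mul_one, sub_eq_zero] at this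
    rw [hK', Matrix.mul_assoc, ← this]
  have hKn : spectralNorm K ≤ 1 := by
    rw [spectralNorm_le_iff zero_le_one]
    intro v
    have h1 := hcD (pinv D *ᵥ v)
    have h2 := reInner_projection_le (P := D * pinv D) sD.left_herm
        (by rw [← Matrix.mul_assoc, sD.mul_mul_self]) v
    rw [mulVec_mulVec, mulVec_mulVec, ← hK'] at h1
    linarith
  have hκ : Kᴴ = D * (pinv D * Kᴴ) := by
    have : K = K * (D * pinv D) := by
      rw [hK', Matrix.mul_assoc, ← Matrix.mul_assoc (pinv D), sD.self_mul_mul]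
    have := congrArg conjTranspose this
    rwa [conjTranspose_mul, sD.left_herm, Matrix.mul_assoc] at this
  have hRs : Rᴴ = R := by rw [hR, psdSqrt_conjTranspose]
  have hRR : R * R = 1 - K * Kᴴ := by
    rw [hR, psdSqrt_mul_self (posSemidef_one_sub_mul_conjTranspose hKn)]
  -- the data for the first block row, obtained by applying `^*`
  have hEs : (k.tr D)ᴴ = k.tr D := by rw [← k.tr_conjTranspose, hDs]
  have hSs : (k.tr R)ᴴ = k.tr R := by rw [← k.tr_conjTranspose, hRs]
  have hPtr : k.tr P = (μ : 𝕜) ^ 2 • 1 - a * aᴴ := by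
    rw [hP, k.tr_sub, k.tr_mul, k.tr_conjTranspose, ha, ← RCLike.ofReal_pow, k.tr_smul_ofReal,
      k.tr_one]
    rcases hε with rfl | rfl <;> simp
  have hEE : k.tr D * k.tr D = (μ : 𝕜) ^ 2 • 1 - a * aᴴ := by
    rw [← k.tr_mul, hDD, hPtr]
  -- Because `a^* = ε a`, applying `^*` to `D` yields exactly the other defect operator `E`, so `E`
  -- needs no separate construction. The row datum is accordingly `L = ε K^*`.
  have haD : a * D = k.tr D * a := by
    rw [hD, ← k.psdSqrt_tr hPs]
    refine psdSqrt_intertwine hPs (by rw [← k.tr_conjTranspose, hPs]) ?_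
    rw [hPtr, hP]
    simp [Matrix.mul_sub, Matrix.sub_mul, Matrix.mul_assoc]
  have hb : ε • k.tr c = k.tr D * (ε • k.tr K) := by
    rw [← hKD, k.tr_mul, Matrix.mul_smul]
  have hSS : k.tr R * k.tr R = 1 - (ε • k.tr K)ᴴ * (ε • k.tr K) := by
    rw [← k.tr_mul, hRR, k.tr_sub, k.tr_one, k.tr_mul, k.tr_conjTranspose]
    rcases hε with rfl | rfl <;> simp
  have hlam : ε • k.tr K = k.tr D * (ε • k.tr (pinv D * Kᴴ)ᴴ) := by
    have := congrArg conjTranspose hκ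
    rw [conjTranspose_conjTranspose, conjTranspose_mul, hDs] at this
    conv_lhs => rw [this, k.tr_mul]
    rw [Matrix.mul_smul]
  have hmid : K * aᴴ * (ε • k.tr K) = ε • (K * aᴴ * k.tr K) := by rw [Matrix.mul_smul]
  have hDD' : D * D = (μ : 𝕜) ^ 2 • 1 - aᴴ * a := by rw [hDD, hP]
  have hmidtr : k.tr (ε • (K * aᴴ * k.tr K)) = ε • (ε • (K * aᴴ * k.tr K)) := by
    rw [k.tr_zsmul, k.tr_mul, k.tr_mul, k.tr_tr, k.tr_conjTranspose, ha]
    rcases hε with rfl | rfl <;> simp [Matrix.mul_assoc]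
  constructor
  · rintro ⟨hx, hn⟩
    -- For `μ = 0` the factorization lemma is unavailable, but then `a` and `x` vanish and `Z = 0`
    -- works.
    rcases hμ.eq_or_lt with h0 | hpos
    · refine ⟨0, ?_, ?_, ?_⟩
      · cases k <;> simp [FormKind.tr]
      · rw [spectralNorm_le_iff zero_le_one]; intro v; simpa using reInner_self_nonneg v
      · have ha0 : a = 0 := by
          refine matrix_eq_zero_of_mulVec fun v => reInner_self_eq_zero ?_
          have h1 := hcol v
          have h2 := reInner_self_nonneg (c *ᵥ v)
          have h3 := reInner_self_nonneg (a *ᵥ v)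
          rw [← h0] at h1
          linarith
        have hx0 : x = 0 := by
          refine matrix_eq_zero_of_mulVec fun v => reInner_self_eq_zero ?_
          have h1 := (spectralNorm_fromBlocks_le_iff hμ).1 hn 0 v
          rw [← h0] at h1
          simp only [mulVec_zero, zero_add] at h1
          have h2 := reInner_self_nonneg ((ε • k.tr c) *ᵥ v)
          have h3 := reInner_self_nonneg (x *ᵥ v)
          linarith
        simp [ha0, hx0]
    · rw [hb, ← hKD] at hn
      obtain ⟨Z, hZ1, hZ2⟩ := exists_contraction_factor (S := k.tr R) hpos hRs
        (two_mul_reInner_dilation_le hpos hDs hEs hDD' hEE haD hRs hSs hRR hSS hκ hlam hn)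
      rw [hmid] at hZ2
      -- Applying `^*` to the representation of `x` shows that `ε Z^*` represents the same `x`. The
      -- average of `Z` and `ε Z^*` is then a structured contraction doing so.
      have hGt : x = -(ε • (K * aᴴ * k.tr K)) + (μ : 𝕜) • (R * (ε • k.tr Z) * k.tr R) := by
        have h1 : k.tr x + ε • (ε • (K * aᴴ * k.tr K)) = (μ : 𝕜) • (R * k.tr Z * k.tr R) := by
          rw [← hmidtr, ← k.tr_add, hZ2, k.tr_smul_ofReal, k.tr_mul, k.tr_mul, k.tr_tr,
            Matrix.mul_assoc]
        have h2 : x + ε • (K * aᴴ * k.tr K) = (μ : 𝕜) • (R * (ε • k.tr Z) * k.tr R) := by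
          rw [Matrix.mul_smul, Matrix.smul_mul, smul_comm, ← h1, hx, ← smul_add,
            zsmul_zsmul_of_sign hε]
        rw [← h2]; abel
      refine ⟨((1 / 2 : ℝ) : 𝕜) • (Z + ε • k.tr Z), ?_, ?_, ?_⟩
      · rw [k.tr_smul_ofReal, k.tr_add, k.tr_zsmul, k.tr_tr, smul_comm ε, smul_add ε,
          zsmul_zsmul_of_sign hε, add_comm]
      · rw [spectralNorm_smul]
        have h1 := spectralNorm_add_le Z (ε • k.tr Z)
        have h2 : spectralNorm (ε • k.tr Z) = spectralNorm Z := by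
          have h3 := k.spectralNorm_tr Z
          rcases hε with rfl | rfl
          · simpa using h3
          · have := spectralNorm_smul (-1 : 𝕜) (k.tr Z)
            simpa [h3] using this
        rw [h2] at h1
        have h4 : ‖((1 / 2 : ℝ) : 𝕜)‖ = 1 / 2 := by
          rw [RCLike.norm_ofReal]; norm_num
        rw [h4]
        linarith
      · rw [Matrix.mul_smul, Matrix.smul_mul, Matrix.mul_add, Matrix.add_mul, smul_comm, smul_add]
        have e1 : (μ : 𝕜) • (R * Z * k.tr R) = x + ε • (K * aᴴ * k.tr K) := hZ2.symm
        have e2 : (μ : 𝕜) • (R * (ε • k.tr Z) * k.tr R) = x + ε • (K * aᴴ * k.tr K) := by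
          conv_rhs => rw [hGt]
          abel
        have e3 : ((1 / 2 : ℝ) : 𝕜) * 2 = 1 := by
          rw [mul_two, ← RCLike.ofReal_add]; norm_num
        rw [e1, e2, ← two_smul 𝕜 (x + _), smul_smul, e3, one_smul]
        abel
  · rintro ⟨Z, hZ, hZ1, rfl⟩
    constructor
    · rw [k.tr_add, k.tr_neg, hmidtr, k.tr_smul_ofReal, k.tr_mul, k.tr_mul, k.tr_tr, hZ,
        smul_add, smul_neg, Matrix.smul_mul, Matrix.mul_smul, smul_comm ε (μ : 𝕜), Matrix.mul_assoc R]
    · rw [hb, ← hmid]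
      conv_lhs => enter [1, 3]; rw [← hKD]
      exact spectralNorm_dilation_le hμ hDs hEs hDD' hEE haD hRs hSs hRR hSS hZ1

end Structured

end

section

variable {𝕜 : Type*} [RCLike 𝕜]
variable {n p : Type*} [Fintype n] [Fintype p] [DecidableEq p]

/-! ### The structured mapping problem for the prototype classes -/

section Classes

variable (k : FormKind) {ε : ℤ} {X N : Matrix n p 𝕜} {H : Matrix n n 𝕜}

theorem mul_pinv_mul_self (X : Matrix n p 𝕜) : X * pinv X * (X * pinv X) = X * pinv X := by
  rw [← Matrix.mul_assoc, (pinv_spec X).mul_mul_self]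

/-- With any structured solution `H` at hand, `N X† = H P` and `ε (N X†)^* = P^* H`. In this form
the properties of `solMap` become projection algebra. -/
theorem solMap_eq (hε : ε = 1 ∨ ε = -1) (hH : k.tr H = ε • H) (hX : H * X = N) :
    solMap k ε X N = H * (X * pinv X) + k.tr (X * pinv X) * H -
      k.tr (X * pinv X) * H * (X * pinv X) := by
  have hY : N * pinv X = H * (X * pinv X) := by rw [← hX, Matrix.mul_assoc]
  rw [solMap, hY, k.tr_mul H, hH, Matrix.mul_smul, zsmul_zsmul_of_sign hε, k.tr_mul X, ← hX]
  simp only [Matrix.mul_assoc]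

theorem tr_solMap (hε : ε = 1 ∨ ε = -1) (hH : k.tr H = ε • H) (hX : H * X = N) :
    k.tr (solMap k ε X N) = ε • solMap k ε X N := by
  rw [solMap_eq k hε hH hX]
  generalize X * pinv X = P
  simp only [k.tr_add, k.tr_sub, k.tr_mul, k.tr_tr, hH, smul_add, smul_sub, Matrix.mul_smul,
    Matrix.smul_mul, Matrix.mul_assoc]
  abel

theorem solMap_mul (hε : ε = 1 ∨ ε = -1) (hH : k.tr H = ε • H) (hX : H * X = N) : solMap k ε X N * X = N := by
  rw [solMap_eq k hε hH hX]
  simp only [Matrix.sub_mul, Matrix.add_mul, Matrix.mul_assoc _ (X * pinv X) X,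
    (pinv_spec X).mul_mul_self]
  rw [Matrix.mul_assoc, hX]
  abel

variable [DecidableEq n]

theorem one_sub_mul_pinv_mul (X : Matrix n p 𝕜) : (1 - X * pinv X) * X = 0 := by
  rw [Matrix.sub_mul, (pinv_spec X).mul_mul_self, Matrix.one_mul, sub_self]

theorem solMap_add_eq (hε : ε = 1 ∨ ε = -1) (hH : k.tr H = ε • H) (hX : H * X = N) :
    solMap k ε X N + k.tr (1 - X * pinv X) * H * (1 - X * pinv X) = H := by
  rw [solMap_eq k hε hH hX, k.tr_sub, k.tr_one]
  simp only [Matrix.mul_sub, Matrix.sub_mul, Matrix.one_mul, Matrix.mul_one, Matrix.mul_assoc]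
  abel

/-- All structured solutions of `H X = N`. -/
theorem structured_solution_iff (hε : ε = 1 ∨ ε = -1) (hH : k.tr H = ε • H) (hX : H * X = N) (G : Matrix n n 𝕜) :
    (k.tr G = ε • G ∧ G * X = N) ↔ ∃ Z : Matrix n n 𝕜, k.tr Z = ε • Z ∧
      G = solMap k ε X N + k.tr (1 - X * pinv X) * Z * (1 - X * pinv X) := by
  constructor
  · rintro ⟨h1, h2⟩
    -- The solution itself serves as `Z`, since `solMap` depends on `X` and `N` only.
    exact ⟨G, h1, (solMap_add_eq k hε h1 h2).symm⟩
  · rintro ⟨Z, hZ, rfl⟩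
    constructor
    · rw [k.tr_add, tr_solMap k hε hH hX, k.tr_mul, k.tr_mul, k.tr_tr, hZ, smul_add,
        Matrix.smul_mul, Matrix.mul_smul, Matrix.mul_assoc]
    · rw [Matrix.add_mul, solMap_mul k hε hH hX, Matrix.mul_assoc _ _ X, one_sub_mul_pinv_mul]
      simp

theorem one_sub_mul_solMap_mul (hε : ε = 1 ∨ ε = -1) (hH : k.tr H = ε • H) (hX : H * X = N) :
    k.tr (1 - X * pinv X) * solMap k ε X N * (1 - X * pinv X) = 0 := by
  have h1 : X * pinv X * (1 - X * pinv X) = 0 := by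
    rw [Matrix.mul_sub, mul_pinv_mul_self]; simp
  have h2 : k.tr (1 - X * pinv X) * k.tr (X * pinv X) = 0 := by
    rw [← k.tr_mul, h1]; cases k <;> simp [FormKind.tr]
  rw [solMap_eq k hε hH hX]
  simp only [Matrix.mul_sub (k.tr (1 - X * pinv X)), Matrix.mul_add (k.tr (1 - X * pinv X)),
    ← Matrix.mul_assoc (k.tr (1 - X * pinv X)), h2]
  simp only [Matrix.zero_mul, sub_zero, add_zero]
  rw [Matrix.mul_assoc, h1, Matrix.mul_zero]

/-! ### The Frobenius norm -/

theorem tr_conjTranspose_of_conjTranspose_eq {ι : Type*} {P : Matrix ι ι 𝕜} (hP : Pᴴ = P) : (k.tr P)ᴴ = k.tr P := by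
  rw [← k.tr_conjTranspose, hP]

open scoped Matrix.Norms.Frobenius in
theorem FormKind.frobeniusNorm_tr {ι κ : Type*} [Fintype ι] [Fintype κ] (A : Matrix ι κ 𝕜) :
    frobeniusNorm (k.tr A) = frobeniusNorm A := by
  cases k
  · exact frobenius_norm_transpose A
  · exact frobenius_norm_conjTranspose A

theorem im_trace_mul_conjTranspose_mul {ι κ : Type*} [Fintype ι] [Fintype κ]
    (Y : Matrix ι κ 𝕜)
    {T : Matrix ι ι 𝕜} (hT : Tᴴ = T) : RCLike.im (Matrix.trace (Y * Yᴴ * T)) = 0 := by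
  rw [← RCLike.conj_eq_iff_im, starRingEnd_apply, ← trace_conjTranspose, conjTranspose_mul,
    conjTranspose_mul, conjTranspose_conjTranspose, hT, trace_mul_comm]

/-- Pythagoras: by cyclicity of the trace, the cross terms contain `Q^* F Q`, which vanishes for `F
= solMap k ε X N`. -/
theorem frobeniusNorm_structured_sq (hε : ε = 1 ∨ ε = -1) (hH : k.tr H = ε • H) (hX : H * X = N) (Z : Matrix n n 𝕜) :
    frobeniusNorm (solMap k ε X N + k.tr (1 - X * pinv X) * Z * (1 - X * pinv X)) ^ 2 =
      frobeniusNorm (solMap k ε X N) ^ 2 +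
        frobeniusNorm (k.tr (1 - X * pinv X) * Z * (1 - X * pinv X)) ^ 2 := by
  obtain ⟨F, hF⟩ : ∃ F, F = solMap k ε X N := ⟨_, rfl⟩
  obtain ⟨Q, hQ⟩ : ∃ Q, Q = 1 - X * pinv X := ⟨_, rfl⟩
  have h0 := one_sub_mul_solMap_mul k hε hH hX
  have hQs : Qᴴ = Q := by rw [hQ, conjTranspose_sub, (pinv_spec X).left_herm, conjTranspose_one]
  have hQt := tr_conjTranspose_of_conjTranspose_eq k hQs
  rw [← hF, ← hQ] at h0 ⊢
  have hc : Matrix.trace ((k.tr Q * Z * Q)ᴴ * F) = 0 := by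
    rw [conjTranspose_mul, conjTranspose_mul, hQs, hQt, Matrix.mul_assoc, trace_mul_comm,
      Matrix.mul_assoc, Matrix.mul_assoc, ← Matrix.mul_assoc (k.tr Q), h0]
    simp
  have hc' : Matrix.trace (Fᴴ * (k.tr Q * Z * Q)) = 0 := by
    have := congrArg star hc
    rwa [← trace_conjTranspose, conjTranspose_mul, conjTranspose_conjTranspose, star_zero] at this
  rw [frobeniusNorm_sq, frobeniusNorm_sq, frobeniusNorm_sq, conjTranspose_add, Matrix.add_mul,
    Matrix.mul_add, Matrix.mul_add, trace_add, trace_add, trace_add, hc, hc']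
  simp

/-- Write `F = H P + T H (1 - P)` with `T = P^*`, an orthogonal sum. The second summand contributes
`‖T H‖² - ‖T H P‖²`, where `‖T H‖ = ‖H P‖` by the symmetry of `H` and `‖T H P‖²` is the trace term.
-/
theorem frobeniusNorm_solMap_sq (hε : ε = 1 ∨ ε = -1) (hH : k.tr H = ε • H) (hX : H * X = N) :
    frobeniusNorm (solMap k ε X N) ^ 2 = 2 * frobeniusNorm (N * pinv X) ^ 2 -
      RCLike.re (Matrix.trace (N * pinv X * (N * pinv X)ᴴ * k.tr (X * pinv X))) := by
  obtain ⟨P, hP⟩ : ∃ P, P = X * pinv X := ⟨_, rfl⟩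
  have hPs : Pᴴ = P := by rw [hP, (pinv_spec X).left_herm]
  have hPP : P * P = P := by rw [hP, mul_pinv_mul_self]
  have hT := tr_conjTranspose_of_conjTranspose_eq k hPs
  have hTT : k.tr P * k.tr P = k.tr P := by rw [← k.tr_mul, hPP]
  have hY : N * pinv X = H * P := by rw [← hX, Matrix.mul_assoc, hP]
  rw [solMap_eq k hε hH hX, hY, ← hP, frobeniusNorm_sq, frobeniusNorm_sq]
  obtain ⟨T, hTd⟩ : ∃ T, T = k.tr P := ⟨_, rfl⟩
  rw [← hTd] at hT hTT ⊢
  have hW : RCLike.re (Matrix.trace ((T * H)ᴴ * (T * H))) =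
      RCLike.re (Matrix.trace ((H * P)ᴴ * (H * P))) := by
    rw [← frobeniusNorm_sq, ← frobeniusNorm_sq, ← k.frobeniusNorm_tr (T * H), hTd, k.tr_mul,
      k.tr_tr, hH]
    rcases hε with rfl | rfl
    · simp
    · rw [frobeniusNorm_sq, frobeniusNorm_sq]; simp
  have hF : H * P + T * H - T * H * P = H * P + T * H * (1 - P) := by
    rw [Matrix.mul_sub, Matrix.mul_one]; abel
  have hQ : (1 - P)ᴴ = 1 - P := by rw [conjTranspose_sub, conjTranspose_one, hPs]
  have hQQ : (1 - P) * (1 - P) = 1 - P := by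
    rw [Matrix.mul_sub, Matrix.sub_mul, Matrix.sub_mul, hPP]; simp
  have hPQ : P * (1 - P) = 0 := by rw [Matrix.mul_sub, hPP]; simp
  have hQP : (1 - P) * P = 0 := by rw [Matrix.sub_mul, hPP]; simp
  have c1 : Matrix.trace ((H * P)ᴴ * (T * H * (1 - P))) = 0 := by
    rw [conjTranspose_mul, hPs, ← Matrix.mul_assoc, trace_mul_comm,
      ← Matrix.mul_assoc (1 - P), ← Matrix.mul_assoc (1 - P) P, hQP]
    simp
  have c2 : Matrix.trace ((T * H * (1 - P))ᴴ * (H * P)) = 0 := by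
    rw [conjTranspose_mul, hQ, ← Matrix.mul_assoc, trace_mul_comm, ← Matrix.mul_assoc,
      ← Matrix.mul_assoc, hPQ]
    simp
  have c3 : Matrix.trace ((T * H * (1 - P))ᴴ * (T * H * (1 - P))) =
      Matrix.trace ((T * H)ᴴ * (T * H)) - Matrix.trace (H * P * (H * P)ᴴ * T) := by
    rw [conjTranspose_mul _ (1 - P), hQ, ← Matrix.mul_assoc, trace_mul_comm,
      ← Matrix.mul_assoc (1 - P), ← Matrix.mul_assoc (1 - P) (1 - P), hQQ, Matrix.mul_assoc, trace_mul_comm, Matrix.mul_sub, Matrix.mul_one,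
      trace_sub]
    congr 1
    rw [conjTranspose_mul, conjTranspose_mul, hT, hPs, ← Matrix.mul_assoc (H * P),
      Matrix.mul_assoc H P P, hPP, Matrix.mul_assoc (H * P), trace_mul_comm (H * P),
      Matrix.mul_assoc Hᴴ T, ← Matrix.mul_assoc T T, hTT]
    simp only [Matrix.mul_assoc]
  rw [hF, conjTranspose_add, Matrix.add_mul, Matrix.mul_add, Matrix.mul_add, trace_add, trace_add,
    trace_add, c1, c2, c3]
  simp only [map_add, map_sub, map_zero, hW]
  ring

end Classes

end

section

variable {𝕜 : Type*} [RCLike 𝕜]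

/-! ### Isometric factors -/

section Isometry

variable {l m n : Type*} [Fintype l] [Fintype m] [Fintype n] [DecidableEq l] [DecidableEq m]
  [DecidableEq n]

theorem spectralNorm_isometry_mul {A : Matrix l m 𝕜} (hA : Aᴴ * A = 1) (B : Matrix m n 𝕜) :
    spectralNorm (A * B) = spectralNorm B := by
  have h := spectralNorm_le_one_of_isometry hA
  refine le_antisymm ((spectralNorm_mul_le A B).trans
    (mul_le_of_le_one_left (spectralNorm_nonneg B) h)) ?_
  have h2 := spectralNorm_mul_le Aᴴ (A * B)
  rw [← Matrix.mul_assoc, hA, Matrix.one_mul, spectralNorm_conjTranspose] at h2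
  exact h2.trans (mul_le_of_le_one_left (spectralNorm_nonneg _) h)

theorem spectralNorm_mul_coisometry {A : Matrix m n 𝕜} (hA : A * Aᴴ = 1) (B : Matrix l m 𝕜) :
    spectralNorm (B * A) = spectralNorm B := by
  rw [← spectralNorm_conjTranspose, conjTranspose_mul,
    spectralNorm_isometry_mul (by rwa [conjTranspose_conjTranspose]), spectralNorm_conjTranspose]

end Isometry

/-! ### Orthonormal bases adapted to a projection -/

/-- The columns of `U₁` and `U₂` together form an orthonormal basis, and `P` is the orthogonal
projection onto the span of the columns of `U₁`. -/
structure IsSplitting {n n₁ n₂ : Type*} [Fintype n] [Fintype n₁] [Fintype n₂] [DecidableEq n]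
    [DecidableEq n₁] [DecidableEq n₂] (P : Matrix n n 𝕜) (U₁ : Matrix n n₁ 𝕜)
    (U₂ : Matrix n n₂ 𝕜) : Prop where
  left_isometry : U₁ᴴ * U₁ = 1
  right_isometry : U₂ᴴ * U₂ = 1
  orthogonal : U₁ᴴ * U₂ = 0
  complete : U₁ * U₁ᴴ + U₂ * U₂ᴴ = 1
  projection : U₁ * U₁ᴴ = P

section Splitting

variable {n n₁ n₂ : Type*} [Fintype n] [Fintype n₁] [Fintype n₂] [DecidableEq n]
    [DecidableEq n₁] [DecidableEq n₂] {P : Matrix n n 𝕜} {U₁ : Matrix n n₁ 𝕜}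
    {U₂ : Matrix n n₂ 𝕜}

namespace IsSplitting

theorem complement (h : IsSplitting P U₁ U₂) : U₂ * U₂ᴴ = 1 - P := by
  rw [← h.complete, ← h.projection]; abel

theorem mul_left (h : IsSplitting P U₁ U₂) : P * U₁ = U₁ := by
  rw [← h.projection, Matrix.mul_assoc, h.left_isometry, Matrix.mul_one]

theorem mul_right (h : IsSplitting P U₁ U₂) : P * U₂ = 0 := by
  rw [← h.projection, Matrix.mul_assoc, h.orthogonal, Matrix.mul_zero]

/-- The block matrix is `U^* H U` for the unitary `U = [U₁ U₂]`. -/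
theorem spectralNorm_blocks (h : IsSplitting P U₁ U₂) (k : FormKind) (H : Matrix n n 𝕜) :
    spectralNorm (fromBlocks (k.tr U₁ * H * U₁) (k.tr U₁ * H * U₂) (k.tr U₂ * H * U₁)
      (k.tr U₂ * H * U₂)) = spectralNorm H := by
  have hV : fromRows (k.tr U₁) (k.tr U₂) = k.tr (fromCols U₁ U₂) := by
    cases k
    · simp [FormKind.tr, transpose_fromCols]
    · simp [FormKind.tr, conjTranspose_fromCols_eq_fromRows_conjTranspose]
  have h21 : U₂ᴴ * U₁ = 0 := by
    have := congrArg conjTranspose h.orthogonal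
    rwa [conjTranspose_mul, conjTranspose_conjTranspose, conjTranspose_zero] at this
  have hU : (fromCols U₁ U₂)ᴴ * fromCols U₁ U₂ = 1 := by
    rw [conjTranspose_fromCols_eq_fromRows_conjTranspose, fromRows_mul_fromCols, h.left_isometry,
      h.right_isometry, h.orthogonal, h21, fromBlocks_one]
  have hU' : fromCols U₁ U₂ * (fromCols U₁ U₂)ᴴ = 1 := by
    rw [conjTranspose_fromCols_eq_fromRows_conjTranspose, fromCols_mul_fromRows, h.complete]
  have e : fromBlocks (k.tr U₁ * H * U₁) (k.tr U₁ * H * U₂) (k.tr U₂ * H * U₁)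
      (k.tr U₂ * H * U₂) = k.tr (fromCols U₁ U₂) * (H * fromCols U₁ U₂) := by
    rw [← hV, mul_fromCols, fromRows_mul_fromCols]
    simp only [Matrix.mul_assoc]
  rw [e, spectralNorm_isometry_mul, spectralNorm_mul_coisometry hU']
  rw [← k.tr_conjTranspose, ← k.tr_mul, hU', k.tr_one]

end IsSplitting

/-! ### Structured solutions of minimal spectral norm -/

variable {p : Type*} [Fintype p] [DecidableEq p]

/-- As `Q = U₂ U₂ᴴ`, the free term `Q^* Z Q` depends only on the compression `x = U₂^* Z U₂`, an
arbitrary structured matrix of the smaller size. -/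
theorem structured_solution_iff_block (k : FormKind) {ε : ℤ} (hε : ε = 1 ∨ ε = -1)
    {X N : Matrix n p 𝕜} {H : Matrix n n 𝕜} (hs : IsSplitting (X * pinv X) U₁ U₂)
    (hH : k.tr H = ε • H) (hX : H * X = N) (G : Matrix n n 𝕜) :
    (k.tr G = ε • G ∧ G * X = N) ↔ ∃ x : Matrix n₂ n₂ 𝕜, k.tr x = ε • x ∧
      G = solMap k ε X N + (k.tr U₂)ᴴ * x * U₂ᴴ := by
  have hQ := hs.complement
  have hQt : k.tr (1 - X * pinv X) = (k.tr U₂)ᴴ * k.tr U₂ := by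
    rw [← hQ, k.tr_mul, k.tr_conjTranspose]
  rw [structured_solution_iff k hε hH hX]
  constructor
  · rintro ⟨Z, hZ, rfl⟩
    refine ⟨k.tr U₂ * Z * U₂, ?_, ?_⟩
    · rw [k.tr_mul, k.tr_mul, k.tr_tr, hZ, Matrix.smul_mul, Matrix.mul_smul, Matrix.mul_assoc]
    · rw [hQt, ← hQ]
      simp only [Matrix.mul_assoc]
  · rintro ⟨x, hx, rfl⟩
    refine ⟨(k.tr U₂)ᴴ * x * U₂ᴴ, ?_, ?_⟩
    · rw [k.tr_mul, k.tr_mul, k.tr_conjTranspose, k.tr_conjTranspose, k.tr_tr, hx,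
        Matrix.smul_mul, Matrix.mul_smul, Matrix.mul_assoc]
    · have h1 : k.tr U₂ * (k.tr U₂)ᴴ = 1 := by
        rw [← k.tr_conjTranspose, ← k.tr_mul, hs.right_isometry, k.tr_one]
      rw [hQt, ← hQ]
      congr 1
      calc (k.tr U₂)ᴴ * x * U₂ᴴ
          = (k.tr U₂)ᴴ * (k.tr U₂ * (k.tr U₂)ᴴ) * x * ((U₂ᴴ * U₂) * U₂ᴴ) := by
            rw [h1, hs.right_isometry]; simp
        _ = _ := by simp only [Matrix.mul_assoc]

/-- All structured solutions of `H X = N` whose spectral norm is at most `‖N X†‖₂`. -/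
theorem structured_solution_norm_le_iff (k : FormKind) {ε : ℤ} (hε : ε = 1 ∨ ε = -1)
    {X N : Matrix n p 𝕜} {H : Matrix n n 𝕜} (hs : IsSplitting (X * pinv X) U₁ U₂)
    (hH : k.tr H = ε • H) (hX : H * X = N) {μ : ℝ} (hμ : μ = spectralNorm (N * pinv X))
    {a : Matrix n₁ n₁ 𝕜} (ha : a = k.tr U₁ * (N * pinv X) * U₁) {K : Matrix n₂ n₁ 𝕜}
    (hK : K = k.tr U₂ * (N * pinv X) * U₁ * psdInvSqrt ((μ : 𝕜) ^ 2 • 1 - aᴴ * a))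
    {R : Matrix n₂ n₂ 𝕜} (hR : R = psdSqrt (1 - K * Kᴴ)) (G : Matrix n n 𝕜) :
    (k.tr G = ε • G ∧ G * X = N ∧ spectralNorm G ≤ μ) ↔
      ∃ Z : Matrix n₂ n₂ 𝕜, k.tr Z = ε • Z ∧ spectralNorm Z ≤ 1 ∧
        G = solMap k ε X N + (k.tr U₂)ᴴ *
          (-(ε • (K * aᴴ * k.tr K)) + (μ : 𝕜) • (R * Z * k.tr R)) * U₂ᴴ := by
  have hμ0 : 0 ≤ μ := hμ ▸ spectralNorm_nonneg _
  -- From `U₁ = X X† U₁`: the first block column is the same for all solutions.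
  have hcolumn : ∀ G : Matrix n n 𝕜, G * X = N → G * U₁ = N * pinv X * U₁ := by
    intro G hG
    conv_lhs => rw [← hs.mul_left, ← Matrix.mul_assoc, ← Matrix.mul_assoc, hG]
  have ha' : k.tr a = ε • a := by
    have : a = k.tr U₁ * H * U₁ := by rw [ha, Matrix.mul_assoc, ← hcolumn H hX, Matrix.mul_assoc]
    rw [this, k.tr_mul, k.tr_mul, k.tr_tr, hH, Matrix.smul_mul, Matrix.mul_smul, Matrix.mul_assoc]
  obtain ⟨c, hc⟩ : ∃ c, c = k.tr U₂ * (N * pinv X) * U₁ := ⟨_, rfl⟩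
  rw [← hc] at hK
  have hcol : ∀ v, reInner (a *ᵥ v) (a *ᵥ v) + reInner (c *ᵥ v) (c *ᵥ v) ≤
      μ ^ 2 * reInner v v := by
    intro v
    obtain ⟨w, hw⟩ : ∃ w, w = (N * pinv X) *ᵥ (U₁ *ᵥ v) := ⟨_, rfl⟩
    have e1 : a *ᵥ v = k.tr U₁ *ᵥ w := by
      rw [ha, hw, mulVec_mulVec, mulVec_mulVec, Matrix.mul_assoc]
    have e2 : c *ᵥ v = k.tr U₂ *ᵥ w := by
      rw [hc, hw, mulVec_mulVec, mulVec_mulVec, Matrix.mul_assoc]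
    have e3 : (k.tr U₁)ᴴ * k.tr U₁ + (k.tr U₂)ᴴ * k.tr U₂ = 1 := by
      rw [← k.tr_conjTranspose, ← k.tr_conjTranspose, ← k.tr_mul, ← k.tr_mul, ← k.tr_add,
        hs.complete, k.tr_one]
    rw [e1, e2, reInner_mulVec_left, reInner_mulVec_left, ← reInner_add_right, mulVec_mulVec,
      mulVec_mulVec, ← add_mulVec, e3, one_mulVec, hw]
    have h1 := (spectralNorm_le_iff hμ0).1 hμ.ge (U₁ *ᵥ v)
    rwa [reInner_mulVec_left U₁, mulVec_mulVec v U₁ᴴ, hs.left_isometry, one_mulVec] at h1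
  have hblock : ∀ x : Matrix n₂ n₂ 𝕜, k.tr x = ε • x →
      spectralNorm (solMap k ε X N + (k.tr U₂)ᴴ * x * U₂ᴴ) =
        spectralNorm (fromBlocks a (ε • k.tr c) c x) := by
    intro x hx
    obtain ⟨G, hG⟩ : ∃ G, G = solMap k ε X N + (k.tr U₂)ᴴ * x * U₂ᴴ := ⟨_, rfl⟩
    obtain ⟨hG1, hG2⟩ := (structured_solution_iff_block k hε hs hH hX G).2 ⟨x, hx, hG⟩
    rw [← hG, ← hs.spectralNorm_blocks k G]
    have b11 : k.tr U₁ * G * U₁ = a := by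
      rw [ha, Matrix.mul_assoc, hcolumn G hG2, ← Matrix.mul_assoc]
    have b21 : k.tr U₂ * G * U₁ = c := by
      rw [hc, Matrix.mul_assoc, hcolumn G hG2, ← Matrix.mul_assoc]
    have b12 : k.tr U₁ * G * U₂ = ε • k.tr c := by
      rw [← b21, k.tr_mul, k.tr_mul, k.tr_tr, hG1, Matrix.smul_mul, Matrix.mul_smul,
        zsmul_zsmul_of_sign hε, Matrix.mul_assoc]
    have b22 : k.tr U₂ * G * U₂ = x := by
      have h1 : k.tr U₂ * (k.tr U₂)ᴴ = 1 := by
        rw [← k.tr_conjTranspose, ← k.tr_mul, hs.right_isometry, k.tr_one]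
      have h0 : k.tr U₂ * k.tr (X * pinv X) = 0 := by
        rw [← k.tr_mul, hs.mul_right]; cases k <;> simp [FormKind.tr]
      have h2 : k.tr U₂ * solMap k ε X N * U₂ = 0 := by
        rw [solMap_eq k hε hH hX]
        simp only [Matrix.mul_sub (k.tr U₂), Matrix.mul_add (k.tr U₂),
          ← Matrix.mul_assoc (k.tr U₂) (k.tr (X * pinv X)), Matrix.mul_assoc (k.tr (X * pinv X)),
          h0, Matrix.zero_mul, add_zero, sub_zero]
        rw [Matrix.mul_assoc, Matrix.mul_assoc, hs.mul_right]
        simp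
      rw [hG, Matrix.mul_add, Matrix.add_mul, h2, zero_add]
      calc k.tr U₂ * ((k.tr U₂)ᴴ * x * U₂ᴴ) * U₂
          = (k.tr U₂ * (k.tr U₂)ᴴ) * x * (U₂ᴴ * U₂) := by simp only [Matrix.mul_assoc]
        _ = x := by rw [h1, hs.right_isometry]; simp
    rw [b11, b21, b12, b22]
  have hdil := structured_dilation_iff k hε hμ0 ha' hcol hK hR
  constructor
  · rintro ⟨h1, h2, h3⟩
    obtain ⟨x, hx, rfl⟩ := (structured_solution_iff_block k hε hs hH hX G).1 ⟨h1, h2⟩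
    rw [hblock x hx] at h3
    obtain ⟨Z, hZ, hZ1, hxZ⟩ := (hdil x).1 ⟨hx, h3⟩
    exact ⟨Z, hZ, hZ1, by rw [hxZ]⟩
  · rintro ⟨Z, hZ, hZ1, hG⟩
    obtain ⟨hx, hn⟩ := (hdil _).2 ⟨Z, hZ, hZ1, rfl⟩
    rw [← hblock _ hx, ← hG] at hn
    obtain ⟨h1, h2⟩ := (structured_solution_iff_block k hε hs hH hX G).2 ⟨_, hx, hG⟩
    exact ⟨h1, h2, hn⟩

/-! ### Splittings from unitary matrices -/

/-- Two complementary predicates, rather than `q` and its negation, allow the index types `i < r`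
and `r ≤ i` of `leftCols` and `rightCols`. -/
theorem isSplitting_of_unitary {U : Matrix n n 𝕜} (hU : U ∈ Matrix.unitaryGroup n 𝕜)
    {q q' : n → Prop} [DecidablePred q] [DecidablePred q'] (hq : ∀ i, q' i ↔ ¬ q i) :
    IsSplitting (U * diagonal (fun i => if q i then 1 else 0) * Uᴴ)
      (U.submatrix id (Subtype.val : {i // q i} → n))
      (U.submatrix id (Subtype.val : {i // q' i} → n)) := by
  have h1 : Uᴴ * U = 1 := Matrix.mem_unitaryGroup_iff'.1 hU
  have h2 : U * Uᴴ = 1 := Matrix.mem_unitaryGroup_iff.1 hU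
  have key : ∀ (r : n → Prop) [DecidablePred r],
      U.submatrix id (Subtype.val : {i // r i} → n) *
        (U.submatrix id (Subtype.val : {i // r i} → n))ᴴ =
      U * diagonal (fun i => if r i then 1 else 0) * Uᴴ := by
    intro r _
    ext i j
    rw [Matrix.mul_apply, Matrix.mul_apply]
    simp only [submatrix_apply, conjTranspose_apply, id, mul_diagonal]
    rw [← Finset.sum_subtype (Finset.univ.filter r) (by simp) (fun x => U i x * star (U j x)),
      Finset.sum_filter]
    refine Finset.sum_congr rfl fun x _ => ?_
    split_ifs <;> simp
  refine ⟨?_, ?_, ?_, ?_, key q⟩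
  · ext i j
    have := congrFun (congrFun h1 i.1) j.1
    simpa [Matrix.mul_apply, Matrix.one_apply, Subtype.ext_iff] using this
  · ext i j
    have := congrFun (congrFun h1 i.1) j.1
    simpa [Matrix.mul_apply, Matrix.one_apply, Subtype.ext_iff] using this
  · ext i j
    have := congrFun (congrFun h1 i.1) j.1
    have hij : i.1 ≠ j.1 := fun e => (hq j.1).1 j.2 (e ▸ i.2)
    simpa [Matrix.mul_apply, Matrix.one_apply, hij] using this
  · rw [key q, key q', ← Matrix.add_mul, ← Matrix.mul_add, diagonal_add]
    have : (fun i => (if q i then (1 : 𝕜) else 0) + if q' i then 1 else 0) = fun _ => 1 := by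
      ext i
      by_cases h : q i <;> simp [hq, h]
    rw [this, diagonal_one, Matrix.mul_one, h2]

/-- The eigenvalues of an orthogonal projection are 0 and 1, so an eigenvector basis splits. This
supplies a basis for the minimal norm without a given singular value decomposition. -/
theorem exists_isSplitting (h1 : Pᴴ = P) (h2 : P * P = P) :
    ∃ (q q' : n → Prop) (_ : DecidablePred q) (_ : DecidablePred q')
      (U₁ : Matrix n {i // q i} 𝕜) (U₂ : Matrix n {i // q' i} 𝕜), IsSplitting P U₁ U₂ := by
  classical
  have hP : P.IsHermitian := h1
  obtain ⟨U, hU⟩ : ∃ U : Matrix n n 𝕜, U = hP.eigenvectorUnitary := ⟨_, rfl⟩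
  have hUm : U ∈ Matrix.unitaryGroup n 𝕜 := hU ▸ hP.eigenvectorUnitary.2
  have hUU : Uᴴ * U = 1 := Matrix.mem_unitaryGroup_iff'.1 hUm
  obtain ⟨d, hd⟩ : ∃ d : n → 𝕜, d = RCLike.ofReal ∘ hP.eigenvalues := ⟨_, rfl⟩
  have hs : P = U * diagonal d * Uᴴ := by
    have := hP.spectral_theorem
    rw [Unitary.conjStarAlgAut_apply] at this
    rw [hU, hd]
    exact this
  have hdd : diagonal d * diagonal d = diagonal d := by
    have e : Uᴴ * P * U = diagonal d := by
      rw [hs]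
      calc Uᴴ * (U * diagonal d * Uᴴ) * U = (Uᴴ * U) * diagonal d * (Uᴴ * U) := by
            simp only [Matrix.mul_assoc]
        _ = diagonal d := by rw [hUU]; simp
    have hUU' : U * Uᴴ = 1 := Matrix.mem_unitaryGroup_iff.1 hUm
    calc diagonal d * diagonal d = Uᴴ * P * (U * Uᴴ) * P * U := by
          rw [← e]; simp only [Matrix.mul_assoc]
      _ = Uᴴ * (P * P) * U := by rw [hUU']; simp only [Matrix.mul_assoc, Matrix.one_mul]
      _ = diagonal d := by rw [h2, e]
  have hd01 : d = fun i => if d i = 1 then 1 else 0 := by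
    ext i
    have := congrFun (congrFun hdd i) i
    rw [diagonal_mul_diagonal, diagonal_apply_eq, diagonal_apply_eq] at this
    split_ifs with h
    · exact h
    · by_contra h0
      exact h (mul_left_cancel₀ h0 (by rw [this, mul_one]))
  have := isSplitting_of_unitary hUm (q := fun i => d i = 1) (q' := fun i => ¬ d i = 1)
    (fun _ => Iff.rfl)
  rw [← hd01, ← hs] at this
  exact ⟨_, _, inferInstance, inferInstance, _, _, this⟩

end Splitting

end

section

variable {𝕜 : Type*} [RCLike 𝕜]

/-! ### The splitting given by a singular value decomposition -/

theorem lt_card_iff_mem_of_lower {n : ℕ} {T : Finset (Fin n)}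
    (hT : ∀ i j, i ≤ j → j ∈ T → i ∈ T) (i : Fin n) : (i : ℕ) < T.card ↔ i ∈ T := by
  constructor
  · intro h
    by_contra hi
    have hsub : T ⊆ Finset.Iio i := by
      intro j hj
      rw [Finset.mem_Iio]
      by_contra hij
      exact hi (hT i j (not_lt.1 hij) hj)
    have := Finset.card_le_card hsub
    rw [Fin.card_Iio] at this
    omega
  · intro h
    have hsub : Finset.Iic i ⊆ T := fun j hj => hT j i (Finset.mem_Iic.1 hj) h
    have := Finset.card_le_card hsub
    rw [Fin.card_Iic] at this
    omega

/-- Both `P` and `X X†` are Hermitian and fix the range of `X`, which contains their ranges. Each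
absorbs the other, and taking adjoints identifies them. -/
theorem eq_mul_pinv_of_range {m n : Type*} [Fintype m] [Fintype n] [DecidableEq n]
    {X : Matrix m n 𝕜} {P : Matrix m m 𝕜} (hP : Pᴴ = P) (h1 : P * X = X) {C : Matrix n m 𝕜}
    (h2 : P = X * C) : P = X * pinv X := by
  have hs := pinv_spec X
  have e1 : X * pinv X * P = P := by
    conv_lhs => rw [h2, ← Matrix.mul_assoc, hs.mul_mul_self]
    exact h2.symm
  have e2 : P * (X * pinv X) = X * pinv X := by rw [← Matrix.mul_assoc, h1]
  have e3 := congrArg conjTranspose e2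
  rw [conjTranspose_mul, hs.left_herm, hP, e1] at e3
  exact e3

open scoped ComplexOrder in
theorem IsSVD.isSplitting {n p : ℕ} {X : Matrix (Fin n) (Fin p) 𝕜} {U : Matrix (Fin n) (Fin n) 𝕜}
    {s : ℕ → ℝ} {V : Matrix (Fin p) (Fin p) 𝕜} (h : IsSVD X U s V) :
    IsSplitting (X * pinv X) (leftCols U X.rank) (rightCols U X.rank) := by
  classical
  -- The eigenvalues of `X Xᴴ`. The sequence `s` is defined beyond the last column, so its values at
  -- `i ≥ p` must be cut off.
  obtain ⟨d, hd⟩ : ∃ d : Fin n → 𝕜, d = fun i : Fin n =>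
      if (i : ℕ) < p then ((s i : ℝ) : 𝕜) ^ 2 else 0 := ⟨_, rfl⟩
  have hVV : Vᴴ * V = 1 := Matrix.mem_unitaryGroup_iff'.1 h.unitary_right
  have hUU : Uᴴ * U = 1 := Matrix.mem_unitaryGroup_iff'.1 h.unitary_left
  have hUU' : U * Uᴴ = 1 := Matrix.mem_unitaryGroup_iff.1 h.unitary_left
  have hXX : X * Xᴴ = U * diagonal d * Uᴴ := by
    obtain ⟨T, hT⟩ : ∃ T : Matrix (Fin n) (Fin p) 𝕜,
        T = Matrix.of fun (i : Fin n) (j : Fin p) => if (i : ℕ) = (j : ℕ) then ((s i : ℝ) : 𝕜) else 0 := ⟨_, rfl⟩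
    have hX : X = U * T * Vᴴ := by rw [hT]; exact h.eq
    have hdiag : T * Tᴴ = diagonal d := by
      ext i j
      rw [Matrix.mul_apply, hT, hd]
      simp only [conjTranspose_apply, of_apply, diagonal_apply]
      by_cases hij : i = j
      · subst hij
        rw [if_pos rfl]
        by_cases hi : (i : ℕ) < p
        · rw [if_pos hi, Finset.sum_eq_single (⟨i, hi⟩ : Fin p)]
          · simp [pow_two]
          · intro b _ hb
            have : ¬ (i : ℕ) = b := fun e => hb (Fin.ext e.symm)
            simp [this]
          · simp
        · rw [if_neg hi]
          refine Finset.sum_eq_zero fun b _ => ?_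
          have : ¬ (i : ℕ) = b := fun e => hi (e ▸ b.2)
          simp [this]
      · rw [if_neg hij]
        refine Finset.sum_eq_zero fun b _ => ?_
        by_cases hb : (i : ℕ) = b
        · have : ¬ (j : ℕ) = b := fun e => hij (Fin.ext (hb.trans e.symm))
          simp [this]
        · simp [hb]
    rw [hX, conjTranspose_mul, conjTranspose_mul, conjTranspose_conjTranspose, ← hdiag]
    calc U * T * Vᴴ * (V * (Tᴴ * Uᴴ)) = U * T * (Vᴴ * V) * Tᴴ * Uᴴ := by
          simp only [Matrix.mul_assoc]
      _ = _ := by rw [hVV, Matrix.mul_one]; simp only [Matrix.mul_assoc]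
  have hdetU : IsUnit U.det := by
    refine IsUnit.of_mul_eq_one (Uᴴ).det ?_
    rw [← det_mul, hUU', det_one]
  have hdetU' : IsUnit (Uᴴ).det := by
    refine IsUnit.of_mul_eq_one U.det ?_
    rw [← det_mul, hUU, det_one]
  have hrank : X.rank = (Finset.univ.filter fun i => d i ≠ 0).card := by
    rw [← Matrix.rank_self_mul_conjTranspose, hXX, Matrix.rank_mul_eq_left_of_isUnit_det _ _ hdetU',
      Matrix.rank_mul_eq_right_of_isUnit_det _ _ hdetU, Matrix.rank_diagonal,
      Fintype.card_subtype]
  -- The rank counts the nonzero `d i`, and monotonicity of `s` places them first.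
  have hlt : ∀ i : Fin n, (i : ℕ) < X.rank ↔ d i ≠ 0 := by
    intro i
    rw [hrank, lt_card_iff_mem_of_lower]
    · simp
    · intro i j hij hj
      simp only [Finset.mem_filter, Finset.mem_univ, true_and, hd] at hj ⊢
      have hjp : (j : ℕ) < p := by
        by_contra hjp
        simp [hjp] at hj
      have hip : (i : ℕ) < p := lt_of_le_of_lt hij hjp
      rw [if_pos hjp] at hj
      rw [if_pos hip]
      have hj0 : s j ≠ 0 := by
        rintro e
        simp [e] at hj
      have hi0 : 0 < s i := lt_of_lt_of_le (lt_of_le_of_ne (h.nonneg j) hj0.symm) (h.anti hij)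
      exact pow_ne_zero _ (RCLike.ofReal_ne_zero.2 hi0.ne')
  have hsp := isSplitting_of_unitary h.unitary_left (q := fun i : Fin n => (i : ℕ) < X.rank)
    (q' := fun i : Fin n => X.rank ≤ (i : ℕ)) (fun i => not_lt.symm)
  obtain ⟨e, he⟩ : ∃ e : Fin n → 𝕜, e = fun i : Fin n => if (i : ℕ) < X.rank then 1 else 0 := ⟨_, rfl⟩
  have hed : diagonal e * diagonal d = diagonal d := by
    rw [diagonal_mul_diagonal]
    congr 1
    ext i
    by_cases hi : d i = 0
    · simp [hi]
    · simp [he, (hlt i).2 hi]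
  have hde : diagonal d * diagonal (fun i => (d i)⁻¹) = diagonal e := by
    rw [diagonal_mul_diagonal]
    congr 1
    ext i
    by_cases hi : d i = 0
    · have : ¬ (i : ℕ) < X.rank := fun hh => (hlt i).1 hh hi
      simp [he, hi, this]
    · simp [he, (hlt i).2 hi, hi]
  rw [← he] at hsp
  obtain ⟨P, hP⟩ : ∃ P, P = U * diagonal e * Uᴴ := ⟨_, rfl⟩
  have hPs : Pᴴ = P := by
    rw [hP, ← hsp.projection, conjTranspose_mul, conjTranspose_conjTranspose]
  have hPXX : P * (X * Xᴴ) = X * Xᴴ := by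
    rw [hXX, hP]
    calc U * diagonal e * Uᴴ * (U * diagonal d * Uᴴ)
        = U * diagonal e * (Uᴴ * U) * diagonal d * Uᴴ := by simp only [Matrix.mul_assoc]
      _ = U * (diagonal e * diagonal d) * Uᴴ := by
          rw [hUU, Matrix.mul_one]; simp only [Matrix.mul_assoc]
      _ = _ := by rw [hed]
  have hPX : P * X = X := by
    rw [← sub_eq_zero, ← self_mul_conjTranspose_eq_zero]
    calc (P * X - X) * (P * X - X)ᴴ
        = (P * (X * Xᴴ) - X * Xᴴ) * P - (P * (X * Xᴴ) - X * Xᴴ) := by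
          rw [conjTranspose_sub, conjTranspose_mul, hPs]
          simp only [Matrix.mul_sub, Matrix.sub_mul, Matrix.mul_assoc]
      _ = 0 := by rw [hPXX]; simp
  -- The convention `0⁻¹ = 0` makes this diagonal the pseudoinverse of `diagonal d`.
  have hPC : P = X * (Xᴴ * (U * diagonal (fun i => (d i)⁻¹) * Uᴴ)) := by
    rw [← Matrix.mul_assoc, hXX, hP]
    calc U * diagonal e * Uᴴ = U * diagonal d * (Uᴴ * U) * diagonal (fun i => (d i)⁻¹) * Uᴴ := by
          rw [hUU, Matrix.mul_one, Matrix.mul_assoc U (diagonal d), hde]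
      _ = _ := by simp only [Matrix.mul_assoc]
  rw [← hP, eq_mul_pinv_of_range hPs hPX hPC] at hsp
  exact hsp

/-! ### Optimal solutions -/

section Optimal

variable {n p : Type*} [Fintype n] [Fintype p] [DecidableEq n] [DecidableEq p]

theorem spectralNorm_mul_pinv_le {A : Matrix n n 𝕜} {X B : Matrix n p 𝕜} (h : A * X = B) :
    spectralNorm (B * pinv X) ≤ spectralNorm A := by
  rw [← h, Matrix.mul_assoc]
  refine (spectralNorm_mul_le _ _).trans
    (mul_le_of_le_one_right (spectralNorm_nonneg A) ?_)
  rw [spectralNorm_le_iff zero_le_one]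
  intro v
  rw [one_pow, one_mul]
  exact reInner_projection_le (pinv_spec X).left_herm (mul_pinv_mul_self X) v

theorem minNorm_eq_of_isLeast {ι κ : Type*} [Fintype ι] {ν : Matrix ι ι 𝕜 → ℝ}
    {S : Set (Matrix ι ι 𝕜)} {X B : Matrix ι κ 𝕜} {A : Matrix ι ι 𝕜} {μ : ℝ} (hA : A ∈ solutionSet S X B) (hAμ : ν A ≤ μ)
    (h : ∀ G ∈ solutionSet S X B, μ ≤ ν G) : minNorm ν S X B = μ := by
  refine IsLeast.csInf_eq ⟨⟨A, hA, le_antisymm hAμ (h A hA)⟩, ?_⟩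
  rintro _ ⟨G, hG, rfl⟩
  exact h G hG

theorem minNorm_spectralNorm_univ {X B : Matrix n p 𝕜} {A : Matrix n n 𝕜} (h : A * X = B) :
    minNorm spectralNorm Set.univ X B = spectralNorm (B * pinv X) := by
  refine minNorm_eq_of_isLeast (A := B * pinv X) ⟨Set.mem_univ _, ?_⟩ le_rfl
    fun G hG => spectralNorm_mul_pinv_le hG.2
  rw [← h, Matrix.mul_assoc, Matrix.mul_assoc, ← Matrix.mul_assoc X, (pinv_spec X).mul_mul_self]

variable {k : FormKind} {ε : ℤ} {M : Matrix n n 𝕜} {S : Set (Matrix n n 𝕜)} {X B : Matrix n p 𝕜}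

theorem isUnit_det_of_unitary (hM : M ∈ Matrix.unitaryGroup n 𝕜) : IsUnit M.det := by
  refine IsUnit.of_mul_eq_one (star M).det ?_
  rw [← det_mul, Matrix.mem_unitaryGroup_iff.1 hM, det_one]

theorem eq_inv_mul_iff (hM : M ∈ Matrix.unitaryGroup n 𝕜) {A G : Matrix n n 𝕜} :
    A = M⁻¹ * G ↔ M * A = G := by
  have hdet := isUnit_det_of_unitary hM
  constructor
  · rintro rfl
    rw [Matrix.mul_nonsing_inv_cancel_left _ _ hdet]
  · rintro rfl
    rw [Matrix.nonsing_inv_mul_cancel_left _ _ hdet]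

theorem spectralNorm_unitary_mul {ι : Type*} [Fintype ι] [DecidableEq ι]
    (hM : M ∈ Matrix.unitaryGroup n 𝕜) (A : Matrix n ι 𝕜) :
    spectralNorm (M * A) = spectralNorm A :=
  spectralNorm_isometry_mul (Matrix.mem_unitaryGroup_iff'.1 hM) A

theorem frobeniusNorm_unitary_mul {ι : Type*} [Fintype ι] (hM : M ∈ Matrix.unitaryGroup n 𝕜)
    (A : Matrix n ι 𝕜) : frobeniusNorm (M * A) = frobeniusNorm A := by
  have hMM : Mᴴ * M = 1 := Matrix.mem_unitaryGroup_iff'.1 hM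
  have : frobeniusNorm (M * A) ^ 2 = frobeniusNorm A ^ 2 := by
    rw [frobeniusNorm_sq, frobeniusNorm_sq, conjTranspose_mul, Matrix.mul_assoc,
      ← Matrix.mul_assoc Mᴴ, hMM, Matrix.one_mul]
  exact (pow_left_inj₀ (frobeniusNorm_nonneg _) (frobeniusNorm_nonneg _) two_ne_zero).1 this

/-- The passage from `A` to `H = M A`: afterwards the scalar product enters only through the
operation `^*` and the sign `ε`. -/
theorem mem_solutionSet_iff {κ : Type*} {X B : Matrix n κ 𝕜} (hM : M ∈ Matrix.unitaryGroup n 𝕜)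
    (hS : ∀ A, A ∈ S ↔ k.tr (M * A) = ε • (M * A)) (A : Matrix n n 𝕜) :
    A ∈ solutionSet S X B ↔ k.tr (M * A) = ε • (M * A) ∧ M * A * X = M * B := by
  rw [solutionSet, Set.mem_ofPred_eq, hS, Matrix.mul_assoc]
  refine and_congr_right fun _ => ⟨fun h => by rw [h], fun h => ?_⟩
  have := congrArg (fun G => M⁻¹ * G) h
  simpa only [Matrix.nonsing_inv_mul_cancel_left _ _ (isUnit_det_of_unitary hM)] using this

theorem isOptimal_frobeniusNorm_iff (hε : ε = 1 ∨ ε = -1) (hM : M ∈ Matrix.unitaryGroup n 𝕜)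
    (hS : ∀ A, A ∈ S ↔ k.tr (M * A) = ε • (M * A)) (hne : (solutionSet S X B).Nonempty)
    (A : Matrix n n 𝕜) :
    IsOptimal frobeniusNorm S X B A ↔ A = M⁻¹ * solMap k ε X (M * B) := by
  obtain ⟨A₀, hA₀⟩ := hne
  obtain ⟨h1, h2⟩ := (mem_solutionSet_iff hM hS A₀).1 hA₀
  obtain ⟨F, hF⟩ : ∃ F, F = solMap k ε X (M * B) := ⟨_, rfl⟩
  obtain ⟨A₁, hA₁⟩ : ∃ A₁, A₁ = M⁻¹ * F := ⟨_, rfl⟩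
  have hMA₁ := (eq_inv_mul_iff hM).1 hA₁
  have hmem : A₁ ∈ solutionSet S X B := by
    rw [mem_solutionSet_iff hM hS, hMA₁, hF]
    exact ⟨tr_solMap k hε h1 h2, solMap_mul k hε h1 h2⟩
  have hsq : ∀ G ∈ solutionSet S X B,
      frobeniusNorm G ^ 2 = frobeniusNorm A₁ ^ 2 + frobeniusNorm (M * G - F) ^ 2 := by
    intro G hG
    obtain ⟨Z, -, hZ⟩ := (structured_solution_iff k hε h1 h2 _).1
      ((mem_solutionSet_iff hM hS G).1 hG)
    rw [← frobeniusNorm_unitary_mul hM G, ← frobeniusNorm_unitary_mul hM A₁, hMA₁, hZ, hF,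
      frobeniusNorm_structured_sq k hε h1 h2, add_sub_cancel_left]
  have hle : ∀ G ∈ solutionSet S X B, frobeniusNorm A₁ ≤ frobeniusNorm G := by
    intro G hG
    refine le_of_sq_le_sq ?_ (frobeniusNorm_nonneg _)
    rw [hsq G hG]
    nlinarith [sq_nonneg (frobeniusNorm (M * G - F))]
  have hmin : minNorm frobeniusNorm S X B = frobeniusNorm A₁ :=
    minNorm_eq_of_isLeast hmem le_rfl hle
  rw [IsOptimal, hmin, ← hF, ← hA₁]
  constructor
  · rintro ⟨hA, hAn⟩
    have h3 := hsq A hA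
    rw [hAn] at h3
    have h4 : frobeniusNorm (M * A - F) ^ 2 = 0 := by linarith
    have h5 := sub_eq_zero.1 (frobeniusNorm_eq_zero (pow_eq_zero_iff two_ne_zero |>.1 h4))
    rw [hA₁, eq_inv_mul_iff hM, h5]
  · rintro rfl
    exact ⟨hmem, rfl⟩

variable {n₁ n₂ : Type*} [Fintype n₁] [Fintype n₂] [DecidableEq n₁] [DecidableEq n₂]
  {U₁ : Matrix n n₁ 𝕜} {U₂ : Matrix n n₂ 𝕜}

theorem spectralNorm_mul_mul_pinv (hM : M ∈ Matrix.unitaryGroup n 𝕜) (X B : Matrix n p 𝕜) :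
    spectralNorm (M * B * pinv X) = spectralNorm (B * pinv X) := by
  rw [Matrix.mul_assoc, spectralNorm_unitary_mul hM]

theorem minNorm_spectralNorm_structured (hε : ε = 1 ∨ ε = -1) (hM : M ∈ Matrix.unitaryGroup n 𝕜)
    (hS : ∀ A, A ∈ S ↔ k.tr (M * A) = ε • (M * A)) (hne : (solutionSet S X B).Nonempty) :
    minNorm spectralNorm S X B = spectralNorm (B * pinv X) := by
  obtain ⟨A₀, hA₀⟩ := hne
  obtain ⟨h1, h2⟩ := (mem_solutionSet_iff hM hS A₀).1 hA₀
  obtain ⟨q, q', _, _, U₁, U₂, hs⟩ := exists_isSplitting (P := X * pinv X)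
    (pinv_spec X).left_herm (mul_pinv_mul_self X)
  -- The contraction `Z = 0` gives a solution attaining the lower bound.
  have hex := (structured_solution_norm_le_iff k hε hs h1 h2 rfl rfl rfl rfl _).2
    ⟨0, by cases k <;> simp [FormKind.tr], by
      rw [spectralNorm_le_iff zero_le_one]; intro v; simpa using reInner_self_nonneg v, rfl⟩
  obtain ⟨G, hG⟩ : ∃ G : Matrix n n 𝕜, k.tr G = ε • G ∧ G * X = M * B ∧
    spectralNorm G ≤ spectralNorm (M * B * pinv X) := ⟨_, hex⟩
  have hMG : M * (M⁻¹ * G) = G := (eq_inv_mul_iff hM).1 rfl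
  refine minNorm_eq_of_isLeast (A := M⁻¹ * G) ?_ ?_ fun G hG => spectralNorm_mul_pinv_le hG.2
  · rw [mem_solutionSet_iff hM hS, hMG]
    exact ⟨hG.1, hG.2.1⟩
  · rw [← spectralNorm_mul_mul_pinv hM, ← spectralNorm_unitary_mul hM (M⁻¹ * G), hMG]
    exact hG.2.2

/-- No solution has norm below `μ`, so being optimal means having norm at most `μ`, which the
dilation result describes. -/
theorem isOptimal_spectralNorm_iff (hε : ε = 1 ∨ ε = -1) (hM : M ∈ Matrix.unitaryGroup n 𝕜)
    (hS : ∀ A, A ∈ S ↔ k.tr (M * A) = ε • (M * A)) (hne : (solutionSet S X B).Nonempty)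
    (hs : IsSplitting (X * pinv X) U₁ U₂) {μ : ℝ} (hμ : μ = spectralNorm (B * pinv X))
    {a : Matrix n₁ n₁ 𝕜} (ha : a = k.tr U₁ * (M * B * pinv X) * U₁) {K : Matrix n₂ n₁ 𝕜}
    (hK : K = k.tr U₂ * (M * B * pinv X) * U₁ * psdInvSqrt ((μ : 𝕜) ^ 2 • 1 - aᴴ * a))
    {R : Matrix n₂ n₂ 𝕜} (hR : R = psdSqrt (1 - K * Kᴴ)) (A : Matrix n n 𝕜) :
    IsOptimal spectralNorm S X B A ↔
      ∃ Z : Matrix n₂ n₂ 𝕜, k.tr Z = ε • Z ∧ spectralNorm Z ≤ 1 ∧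
        A = M⁻¹ * (solMap k ε X (M * B) + (k.tr U₂)ᴴ *
          (-(ε • (K * aᴴ * k.tr K)) + (μ : 𝕜) • (R * Z * k.tr R)) * U₂ᴴ) := by
  have hmin := minNorm_spectralNorm_structured hε hM hS hne
  obtain ⟨A₀, hA₀⟩ := hne
  obtain ⟨h1, h2⟩ := (mem_solutionSet_iff hM hS A₀).1 hA₀
  have key := structured_solution_norm_le_iff k hε hs h1 h2
    (hμ.trans (spectralNorm_mul_mul_pinv hM X B).symm) ha hK hR (M * A)
  simp only [eq_inv_mul_iff hM]
  rw [← key, IsOptimal, hmin, ← hμ, mem_solutionSet_iff hM hS, spectralNorm_unitary_mul hM,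
    and_assoc]
  refine and_congr_right fun h3 => and_congr_right fun h4 => ⟨fun h => h.le, fun h => ?_⟩
  refine le_antisymm h ?_
  rw [hμ]
  exact spectralNorm_mul_pinv_le ((mem_solutionSet_iff hM hS A).2 ⟨h3, h4⟩).2

end Optimal

end

section

variable {𝕜 : Type*} [RCLike 𝕜]

/-! ### The optimal families -/

theorem conjMat_eq {m n : Type*} (A : Matrix m n 𝕜) : conjMat A = Aᵀᴴ := by
  ext; simp [conjMat]

section Families

variable {n p : ℕ} {M : Matrix (Fin n) (Fin n) 𝕜} {X B : Matrix (Fin n) (Fin p) 𝕜}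
  {U : Matrix (Fin n) (Fin n) 𝕜}

/-- Only a change of notation: the block `K` is `U₂ᵀ` times the `K` of `familyT`, and the signs `ε`
are absorbed by `aᵀ = ε a` for `a = U₁ᵀ Y U₁`. -/
theorem isOptimal_iff_familyT {ε : ℤ} {S : Set (Matrix (Fin n) (Fin n) 𝕜)}
    (hε : ε = 1 ∨ ε = -1) (hM : M ∈ Matrix.unitaryGroup (Fin n) 𝕜)
    (hS : ∀ A, A ∈ S ↔ (M * A)ᵀ = ε • (M * A)) (hne : (solutionSet S X B).Nonempty)
    (hs : IsSplitting (X * pinv X) (leftCols U X.rank) (rightCols U X.rank))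
    (A : Matrix (Fin n) (Fin n) 𝕜) :
    IsOptimal spectralNorm S X B A ↔
      ∃ Z : Matrix {i : Fin n // X.rank ≤ (i : ℕ)} {i : Fin n // X.rank ≤ (i : ℕ)} 𝕜,
        Zᵀ = ε • Z ∧ spectralNorm Z ≤ 1 ∧ A = familyT ε M X B U Z := by
  have key := isOptimal_spectralNorm_iff (k := .bilinear) hε hM hS hne hs rfl rfl rfl rfl A
  rw [key]
  refine exists_congr fun Z => and_congr_right fun _ => and_congr_right fun _ => ?_
  obtain ⟨A₀, hA₀⟩ := hne
  obtain ⟨h1, h2⟩ := (mem_solutionSet_iff (k := .bilinear) hM hS A₀).1 hA₀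
  suffices hfam : familyT ε M X B U Z = _ by rw [hfam]
  simp only [familyT, FormKind.tr, conjMat_eq] at h1 ⊢
  generalize leftCols U X.rank = U₁ at hs ⊢
  generalize rightCols U X.rank = U₂ at hs ⊢
  generalize ((spectralNorm (B * pinv X) : ℝ) : 𝕜) = μ
  have hYP : M * B * pinv X * (X * pinv X) = M * B * pinv X := by
    rw [Matrix.mul_assoc, ← Matrix.mul_assoc (pinv X), (pinv_spec X).self_mul_mul]
  have hQ := hs.complement
  have hY : M * B * pinv X = M * A₀ * (X * pinv X) := by rw [← h2, Matrix.mul_assoc]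
  have ha : (U₁ᵀ * (M * B * pinv X) * U₁)ᵀ = ε • (U₁ᵀ * (M * B * pinv X) * U₁) := by
    have : U₁ᵀ * (M * B * pinv X) * U₁ = U₁ᵀ * (M * A₀) * U₁ := by
      rw [hY, Matrix.mul_assoc, Matrix.mul_assoc (M * A₀), hs.mul_left, ← Matrix.mul_assoc]
    rw [this, transpose_mul, transpose_mul, transpose_transpose, h1, Matrix.smul_mul,
      Matrix.mul_smul, ← Matrix.mul_assoc]
  have hconj : U₁ᴴ * (M * B * pinv X * U₁)ᵀᴴ = ε • (U₁ᵀ * (M * B * pinv X) * U₁)ᴴ := by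
    rw [← conjTranspose_mul]
    have e : (M * B * pinv X * U₁)ᵀ * U₁ = ε • (U₁ᵀ * (M * B * pinv X) * U₁) := by
      rw [← ha]; simp [transpose_mul, Matrix.mul_assoc]
    rw [e]
    rcases hε with rfl | rfl <;> simp
  -- Since `Y = Y U₁ U₁ᴴ`, the conjugate of `Y` ends in `U₁ᵀ`, which supplies the missing factor of
  -- `aᴴ a`.
  have hcore : ε • (U₁ᴴ * (M * B * pinv X)ᵀᴴ * (M * B * pinv X) * U₁) =
      (U₁ᵀ * (M * B * pinv X) * U₁)ᴴ * (U₁ᵀ * (M * B * pinv X) * U₁) := by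
    have e1 : (M * B * pinv X)ᵀᴴ = (M * B * pinv X * U₁)ᵀᴴ * U₁ᵀ := by
      conv_lhs => rw [← hYP, ← hs.projection, ← Matrix.mul_assoc, transpose_mul, conjTranspose_mul]
      congr 1
      ext; simp
    have e2 : U₁ᴴ * (M * B * pinv X)ᵀᴴ = ε • (U₁ᵀ * (M * B * pinv X) * U₁)ᴴ * U₁ᵀ := by
      rw [e1, ← Matrix.mul_assoc, hconj]
    rw [e2]
    simp only [Matrix.smul_mul, zsmul_zsmul_of_sign hε, Matrix.mul_assoc]
  rw [hcore]
  generalize hD : psdInvSqrt (μ ^ 2 • 1 - (U₁ᵀ * (M * B * pinv X) * U₁)ᴴ *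
    (U₁ᵀ * (M * B * pinv X) * U₁)) = D
  generalize hYd : M * B * pinv X = Y at *
  have eK : U₂ᵀ * Y * U₁ * D = U₂ᵀ * (Y * U₁ * D) := by simp only [Matrix.mul_assoc]
  rw [eK]
  generalize hK : Y * U₁ * D = K
  have eR1 : U₂ᵀ * K * Kᴴ * U₂ᵀᴴ = (U₂ᵀ * K) * (U₂ᵀ * K)ᴴ := by
    rw [conjTranspose_mul]; simp only [Matrix.mul_assoc]
  have eR2 : psdSqrt (1 - U₂ᴴ * Kᵀᴴ * Kᵀ * U₂) = (psdSqrt (1 - U₂ᵀ * K * (U₂ᵀ * K)ᴴ))ᵀ := by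
    rw [← psdSqrt_transpose (by simp)]
    congr 1
    rw [transpose_sub, transpose_one, transpose_mul, transpose_mul, transpose_transpose,
      conjTranspose_mul, transpose_mul]
    have t1 : U₂ᵀᴴᵀ = U₂ᴴ := by ext; simp
    have t2 : Kᴴᵀ = Kᵀᴴ := by ext; simp
    rw [t1, t2]
    simp only [Matrix.mul_assoc]
  rw [eR1, eR2, ← hQ]
  have t3 : (U₂ * U₂ᴴ)ᵀ = U₂ᵀᴴ * U₂ᵀ := by
    rw [transpose_mul]; congr 1
  rw [t3]
  have emid : M⁻¹ * (U₂ᵀᴴ * U₂ᵀ) * K * U₁ᴴ * (Y * U₁)ᵀᴴ * Kᵀ * (U₂ * U₂ᴴ) =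
      M⁻¹ * (U₂ᵀᴴ * (ε • (U₂ᵀ * K * (U₁ᵀ * Y * U₁)ᴴ * (U₂ᵀ * K)ᵀ)) * U₂ᴴ) := by
    calc _ = M⁻¹ * (U₂ᵀᴴ * U₂ᵀ) * K * (U₁ᴴ * (Y * U₁)ᵀᴴ) * Kᵀ * (U₂ * U₂ᴴ) := by
          simp only [Matrix.mul_assoc]
      _ = _ := by
          rw [hconj, transpose_mul, transpose_transpose]
          simp only [Matrix.mul_smul, Matrix.smul_mul, Matrix.mul_assoc]
  rw [emid]
  simp only [Matrix.mul_add, Matrix.add_mul, Matrix.mul_neg, Matrix.neg_mul, Matrix.mul_smul,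
    Matrix.smul_mul, Matrix.mul_assoc]
  abel

theorem isOptimal_iff_familyH {S : Set (Matrix (Fin n) (Fin n) 𝕜)}
    (hM : M ∈ Matrix.unitaryGroup (Fin n) 𝕜)
    (hS : ∀ A, A ∈ S ↔ (M * A)ᴴ = M * A) (hne : (solutionSet S X B).Nonempty)
    (hs : IsSplitting (X * pinv X) (leftCols U X.rank) (rightCols U X.rank))
    (A : Matrix (Fin n) (Fin n) 𝕜) :
    IsOptimal spectralNorm S X B A ↔
      ∃ Z : Matrix {i : Fin n // X.rank ≤ (i : ℕ)} {i : Fin n // X.rank ≤ (i : ℕ)} 𝕜,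
        Zᴴ = Z ∧ spectralNorm Z ≤ 1 ∧ A = familyH M X B U Z := by
  have hS' : ∀ A, A ∈ S ↔ FormKind.sesquilinear.tr (M * A) = (1 : ℤ) • (M * A) := by
    simpa [FormKind.tr] using hS
  have key := isOptimal_spectralNorm_iff (k := .sesquilinear) (.inl rfl) hM hS' hne hs rfl rfl rfl
    rfl A
  rw [key]
  simp only [one_smul]
  refine exists_congr fun Z => and_congr_right fun _ => and_congr_right fun _ => ?_
  obtain ⟨A₀, hA₀⟩ := hne
  obtain ⟨h1, h2⟩ := (mem_solutionSet_iff (k := .sesquilinear) hM hS' A₀).1 hA₀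
  suffices hfam : familyH M X B U Z = _ by rw [hfam]
  simp only [familyH, FormKind.tr, one_smul] at h1 ⊢
  generalize leftCols U X.rank = U₁ at hs ⊢
  generalize rightCols U X.rank = U₂ at hs ⊢
  generalize ((spectralNorm (B * pinv X) : ℝ) : 𝕜) = μ
  have hYP : M * B * pinv X * (X * pinv X) = M * B * pinv X := by
    rw [Matrix.mul_assoc, ← Matrix.mul_assoc (pinv X), (pinv_spec X).self_mul_mul]
  have hQ := hs.complement
  have hY : M * B * pinv X = M * A₀ * (X * pinv X) := by rw [← h2, Matrix.mul_assoc]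
  have ha : (U₁ᴴ * (M * B * pinv X) * U₁)ᴴ = U₁ᴴ * (M * B * pinv X) * U₁ := by
    have : U₁ᴴ * (M * B * pinv X) * U₁ = U₁ᴴ * (M * A₀) * U₁ := by
      rw [hY, Matrix.mul_assoc, Matrix.mul_assoc (M * A₀), hs.mul_left, ← Matrix.mul_assoc]
    rw [this, conjTranspose_mul, conjTranspose_mul, conjTranspose_conjTranspose, h1,
      ← Matrix.mul_assoc]
  have hcore : U₁ᴴ * (M * B * pinv X) * (M * B * pinv X) * U₁ =
      (U₁ᴴ * (M * B * pinv X) * U₁)ᴴ * (U₁ᴴ * (M * B * pinv X) * U₁) := by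
    rw [ha]
    conv_lhs => enter [1, 1, 2]; rw [← hYP, ← hs.projection]
    simp only [Matrix.mul_assoc]
  rw [hcore]
  generalize hD : psdInvSqrt (μ ^ 2 • 1 - (U₁ᴴ * (M * B * pinv X) * U₁)ᴴ *
    (U₁ᴴ * (M * B * pinv X) * U₁)) = D
  rw [ha]
  generalize M * B * pinv X = Y at *
  have eK : U₂ᴴ * Y * U₁ * D = U₂ᴴ * (Y * U₁ * D) := by simp only [Matrix.mul_assoc]
  rw [eK]
  generalize hK : Y * U₁ * D = K
  have eR1 : U₂ᴴ * K * Kᴴ * U₂ = (U₂ᴴ * K) * (U₂ᴴ * K)ᴴ := by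
    rw [conjTranspose_mul, conjTranspose_conjTranspose]; simp only [Matrix.mul_assoc]
  rw [eR1, psdSqrt_conjTranspose, ← hQ, conjTranspose_mul U₂ᴴ K, conjTranspose_conjTranspose]
  simp only [Matrix.mul_add, Matrix.add_mul, Matrix.mul_neg, Matrix.neg_mul, Matrix.mul_smul,
    Matrix.smul_mul, Matrix.mul_assoc]
  abel

end Families

/-! ### Jordan and Lie algebras -/

namespace MatrixClass

theorem mem_carrier_iff (c : MatrixClass) {n : Type*} (A : Matrix n n 𝕜) :
    A ∈ c.carrier n 𝕜 ↔ c.form.tr A = c.sign • A := by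
  cases c <;> simp [carrier, form, sign, FormKind.tr]

theorem sign_eq (c : MatrixClass) : c.sign = 1 ∨ c.sign = -1 := by
  cases c <;> simp [sign]

theorem exists_form_sign (k : FormKind) {ε : ℤ} (hε : ε = 1 ∨ ε = -1) :
    ∃ c : MatrixClass, c.form = k ∧ c.sign = ε := by
  rcases hε with rfl | rfl <;> cases k
  exacts [⟨sym, rfl, rfl⟩, ⟨herm, rfl, rfl⟩, ⟨skewSym, rfl, rfl⟩, ⟨skewHerm, rfl, rfl⟩]

end MatrixClass

section Algebras

variable {n : Type*} [Fintype n] [DecidableEq n] {M : Matrix n n 𝕜}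

/-- The symmetry sign `δ` of `M` multiplies the sign of the algebra, so `M S` is the class of sign
`δ ε`. -/
theorem adj_eq_zsmul_iff {k : FormKind} {δ ε : ℤ} (hδ : δ = 1 ∨ δ = -1)
    (hU : M ∈ Matrix.unitaryGroup n 𝕜) (hM : k.tr M = δ • M) (A : Matrix n n 𝕜) :
    adj k M A = ε • A ↔ k.tr (M * A) = (δ * ε) • (M * A) := by
  rw [adj, Matrix.mul_assoc, eq_comm, eq_inv_mul_iff hU, k.tr_mul, hM, Matrix.mul_smul,
    Matrix.mul_smul, mul_smul, eq_comm]
  constructor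
  · intro h
    rw [h]
  · intro h
    have := congrArg (fun G => δ • G) h
    simpa only [zsmul_zsmul_of_sign hδ] using this

theorem mem_leftMul_iff (hU : M ∈ Matrix.unitaryGroup n 𝕜) (S : Set (Matrix n n 𝕜))
    (A : Matrix n n 𝕜) : M * A ∈ leftMul M S ↔ A ∈ S := by
  constructor
  · rintro ⟨A', hA', h⟩
    have := (eq_inv_mul_iff hU).2 h
    rw [(eq_inv_mul_iff hU).2 (rfl : M * A = M * A), ← this]
    exact hA'
  · intro h
    exact ⟨A, h, rfl⟩

theorem exists_leftMul_structuredSet_eq (k : FormKind) (hU : M ∈ Matrix.unitaryGroup n 𝕜)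
    (hM : k.tr M = M ∨ k.tr M = -M) (a : AlgebraKind) :
    ∃ c : MatrixClass, leftMul M (structuredSet k M a) = c.carrier n 𝕜 := by
  obtain ⟨δ, hδ, hMδ⟩ : ∃ δ : ℤ, (δ = 1 ∨ δ = -1) ∧ k.tr M = δ • M := by
    rcases hM with h | h
    · exact ⟨1, .inl rfl, by simpa using h⟩
    · exact ⟨-1, .inr rfl, by simpa using h⟩
  obtain ⟨ε, hε, hS⟩ : ∃ ε : ℤ, (ε = 1 ∨ ε = -1) ∧
      ∀ A, A ∈ structuredSet k M a ↔ adj k M A = ε • A := by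
    cases a
    · exact ⟨1, .inl rfl, fun A => by simp [structuredSet]⟩
    · exact ⟨-1, .inr rfl, fun A => by simp [structuredSet]⟩
  have hδε : δ * ε = 1 ∨ δ * ε = -1 := by
    rcases hδ with rfl | rfl <;> rcases hε with rfl | rfl <;> simp
  obtain ⟨c, hc1, hc2⟩ := MatrixClass.exists_form_sign k hδε
  refine ⟨c, Set.ext fun G => ?_⟩
  have hG : G = M * (M⁻¹ * G) := ((eq_inv_mul_iff hU).1 rfl).symm
  rw [hG, mem_leftMul_iff hU, hS, adj_eq_zsmul_iff hδ hU hMδ, c.mem_carrier_iff, hc1, hc2]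

end Algebras

end

end StructuredMapping

end

/-! ### The structured mapping theorem -/

open StructuredMapping in
theorem theorem3p3 {𝕜 : Type*} [RCLike 𝕜] {n p : ℕ}
    (k : FormKind) (M : Matrix (Fin n) (Fin n) 𝕜)
    (hU : M ∈ Matrix.unitaryGroup (Fin n) 𝕜) (hM : k.tr M = M ∨ k.tr M = -M)
    (a : AlgebraKind) (S : Set (Matrix (Fin n) (Fin n) 𝕜)) (hS : S = structuredSet k M a)
    (X B : Matrix (Fin n) (Fin p) 𝕜) (hne : (solutionSet S X B).Nonempty) :
    -- `M S` is one of the four prototype classes, and whichever class `c` it is: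
    (∃ c : MatrixClass, leftMul M S = c.carrier (Fin n) 𝕜) ∧
    ∀ c : MatrixClass, leftMul M S = c.carrier (Fin n) 𝕜 →
      -- all solutions
      (∀ A : Matrix (Fin n) (Fin n) 𝕜, A ∈ solutionSet S X B ↔
        ∃ Z ∈ leftMul M S,
          A = M⁻¹ * solMap c.form c.sign X (M * B)
            + M⁻¹ * c.form.tr (1 - X * pinv X) * Z * (1 - X * pinv X)) ∧
      -- (a) Frobenius norm
      (∀ A : Matrix (Fin n) (Fin n) 𝕜, IsOptimal frobeniusNorm S X B A ↔
        A = M⁻¹ * solMap c.form c.sign X (M * B)) ∧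
      (frobeniusNorm (M⁻¹ * solMap c.form c.sign X (M * B)) =
        √(2 * frobeniusNorm (B * pinv X) ^ 2 -
          RCLike.re (Matrix.trace (M * B * pinv X * (M * B * pinv X).conjTranspose *
            c.form.tr (X * pinv X)))) ∧
        RCLike.im (Matrix.trace (M * B * pinv X * (M * B * pinv X).conjTranspose *
            c.form.tr (X * pinv X))) = 0) ∧
      -- (b) spectral norm
      minNorm spectralNorm S X B = spectralNorm (B * pinv X) ∧
      minNorm spectralNorm Set.univ X B = spectralNorm (B * pinv X) ∧
      (∀ (U : Matrix (Fin n) (Fin n) 𝕜) (s : ℕ → ℝ) (V : Matrix (Fin p) (Fin p) 𝕜),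
        IsSVD X U s V →
        (c = .sym ∨ c = .skewSym → ∀ A : Matrix (Fin n) (Fin n) 𝕜,
          IsOptimal spectralNorm S X B A ↔
            ∃ Z ∈ c.carrier {i : Fin n // X.rank ≤ (i : ℕ)} 𝕜,
              spectralNorm Z ≤ 1 ∧ A = familyT c.sign M X B U Z) ∧
        (c = .herm → ∀ A : Matrix (Fin n) (Fin n) 𝕜,
          IsOptimal spectralNorm S X B A ↔
            ∃ Z ∈ c.carrier {i : Fin n // X.rank ≤ (i : ℕ)} 𝕜,
              spectralNorm Z ≤ 1 ∧ A = familyH M X B U Z) ∧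
        -- skew-Hermitian matrices are considered over the complex field only
        (c = .skewHerm → (RCLike.I : 𝕜) ≠ 0 → ∀ A : Matrix (Fin n) (Fin n) 𝕜,
          (IsOptimal spectralNorm S X B A ↔
            ∃ G, IsOptimal spectralNorm
              {G | M * G ∈ MatrixClass.herm.carrier (Fin n) 𝕜} X ((RCLike.I : 𝕜) • B) G ∧
              A = -(RCLike.I : 𝕜) • G) ∧
          (IsOptimal spectralNorm S X B A ↔
            ∃ Z ∈ MatrixClass.herm.carrier {i : Fin n // X.rank ≤ (i : ℕ)} 𝕜,
              spectralNorm Z ≤ 1 ∧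
              A = -(RCLike.I : 𝕜) • familyH M X ((RCLike.I : 𝕜) • B) U Z))) := by
  refine ⟨hS ▸ exists_leftMul_structuredSet_eq k hU hM a, fun c hc => ?_⟩
  have hε := c.sign_eq
  have hmem : ∀ A, A ∈ S ↔ c.form.tr (M * A) = c.sign • (M * A) := fun A => by
    rw [← mem_leftMul_iff hU, hc, c.mem_carrier_iff]
  obtain ⟨A₀, hA₀⟩ := id hne
  obtain ⟨h1, h2⟩ := (mem_solutionSet_iff hU hmem A₀).1 hA₀
  refine ⟨fun A => ?_, isOptimal_frobeniusNorm_iff hε hU hmem hne, ⟨?_, ?_⟩,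
    minNorm_spectralNorm_structured hε hU hmem hne, minNorm_spectralNorm_univ hA₀.2,
    fun U s V hsvd => ⟨fun hc' A => ?_, fun hc' A => ?_, fun hc' hI A => ?_⟩⟩
  · rw [mem_solutionSet_iff hU hmem, structured_solution_iff _ hε h1 h2]
    refine exists_congr fun Z => ?_
    rw [hc, c.mem_carrier_iff, ← eq_inv_mul_iff hU, Matrix.mul_add]
    simp only [Matrix.mul_assoc]
  · rw [← frobeniusNorm_unitary_mul hU, (eq_inv_mul_iff hU).1 rfl,
      ← Real.sqrt_sq (frobeniusNorm_nonneg (solMap _ _ _ _)), frobeniusNorm_solMap_sq _ hε h1 h2,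
      Matrix.mul_assoc M B, frobeniusNorm_unitary_mul hU]
  · exact im_trace_mul_conjTranspose_mul _
      (tr_conjTranspose_of_conjTranspose_eq _ (pinv_spec X).left_herm)
  · have hform : c.form = .bilinear := by rcases hc' with rfl | rfl <;> rfl
    rw [hform] at hmem
    rw [isOptimal_iff_familyT hε hU hmem hne hsvd.isSplitting]
    simp only [c.mem_carrier_iff, hform, FormKind.tr]
  · subst hc'
    exact isOptimal_iff_familyH hU (by simpa [MatrixClass.form, MatrixClass.sign, FormKind.tr]
      using hmem) hne hsvd.isSplitting A
  · subst hc'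
    have hII : (RCLike.I : 𝕜) * RCLike.I = -1 := RCLike.I_mul_I_of_nonzero hI
    have hnorm : ‖(RCLike.I : 𝕜)‖ = 1 := RCLike.norm_I_of_ne_zero hI
    have hmem' : ∀ A, A ∈ S ↔ (M * A)ᴴ = -(M * A) := by
      simpa [MatrixClass.form, MatrixClass.sign, FormKind.tr] using hmem
    obtain ⟨T, hT⟩ : ∃ T : Set (Matrix (Fin n) (Fin n) 𝕜),
      T = {G | M * G ∈ MatrixClass.herm.carrier (Fin n) 𝕜} := ⟨_, rfl⟩
    have hTmem : ∀ G, G ∈ T ↔ (M * G)ᴴ = M * G := fun G => by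
      rw [hT]; rfl
    have hTmem' : ∀ G, G ∈ T ↔ FormKind.sesquilinear.tr (M * G) = (1 : ℤ) • (M * G) := by
      simpa [FormKind.tr] using hTmem
    -- Multiplication by `i` exchanges skew-Hermitian and Hermitian matrices; `hI` excludes the real
    -- field, where `RCLike.I` is zero.
    have hrot : ∀ A, A ∈ solutionSet S X B ↔
        (RCLike.I : 𝕜) • A ∈ solutionSet T X ((RCLike.I : 𝕜) • B) := by
      intro A
      refine and_congr ?_ ?_
      · rw [hmem', hTmem, Matrix.mul_smul, conjTranspose_smul, RCLike.star_def, RCLike.conj_I,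
          neg_smul, ← smul_neg, smul_right_inj hI, neg_eq_iff_eq_neg]
      · rw [Matrix.smul_mul, smul_right_inj hI]
    have hTne : (solutionSet T X ((RCLike.I : 𝕜) • B)).Nonempty := ⟨_, (hrot A₀).1 hA₀⟩
    -- Both minimal norms are known explicitly and agree because `|i| = 1`.
    have hopt : ∀ A, IsOptimal spectralNorm S X B A ↔
        IsOptimal spectralNorm T X ((RCLike.I : 𝕜) • B) ((RCLike.I : 𝕜) • A) := by
      intro A
      rw [IsOptimal, IsOptimal, hrot, StructuredMapping.spectralNorm_smul, hnorm, one_mul,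
        minNorm_spectralNorm_structured hε hU hmem hne,
        minNorm_spectralNorm_structured (.inl rfl) hU hTmem' hTne, Matrix.smul_mul,
        StructuredMapping.spectralNorm_smul, hnorm, one_mul]
    have hinv : ∀ A G : Matrix (Fin n) (Fin n) 𝕜,
        A = -(RCLike.I : 𝕜) • G ↔ (RCLike.I : 𝕜) • A = G := by
      intro A G
      constructor
      · rintro rfl
        rw [smul_smul, mul_neg, hII, neg_neg, one_smul]
      · rintro rfl
        rw [smul_smul, neg_mul, hII, neg_neg, one_smul]
    rw [← hT, hopt]
    simp only [hinv]
    refine ⟨by simp, ?_⟩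
    exact isOptimal_iff_familyH hU hTmem hTne hsvd.isSplitting _
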